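/- Let $\omega>0$, $t>0$ and $g\in\mathbb{R}$. For $\psi=(\psi_+,\psi_-)\in L^2(\mathbb{R},\mathbb{C}^2)$ write $|\psi|^2=|\psi_+|^2+|\psi_-|^2$, let $$Q_0=\{\psi\in L^2(\mathbb{R},\mathbb{C}^2) : \psi'\in L^2,\ x\psi\in L^2\}$$ (weak derivative), and for $(\sigma,\xi)\in[-1,1]\times\mathbb{R}$ let $$\mathcal{M}_{\sigma,\xi}=\Big\{\psi\in Q_0 : \|\psi\|=1,\ \|\psi_+\|^2-\|\psi_-\|^2=\sigma,\ \int x|\psi|^2\,dx=\xi\Big\}.$$ For $\lambda\in\mathbb{R}$ let $\hat H_0^\lambda=\tfrac12\hat p^2+\tfrac{\omega^2}{2}\hat x^2-t\hat\sigma_x+\lambda g\hat\sigma_z\hat x$ be the quantum Rabi Hamiltonian with scaled coupling, understood through its quadratic form on $Q_0$, $$\langle\psi|\hat H_0^\lambda|\psi\rangle=\tfrac12\int|\psi'|^2\,dx+\tfrac{\omega^2}{2}\int x^2|\psi|^2\,dx-2t\,\mathrm{Re}\int\overline{\psi_+}\psi_-\,dx+\lambda g\,\langle\hat\sigma_z\hat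 x\rangle_\psi,\qquad \langle\hat\sigma_z\hat x\rangle_\psi=\int x\big(|\psi_+|^2-|\psi_-|^2\big)\,dx,$$ and let $F_{\mathrm{LL}}^\lambda(\sigma,\xi)=\inf_{\psi\in\mathcal{M}_{\sigma,\xi}}\langle\psi|\hat H_0^\lambda|\psi\rangle$ be the Levy--Lieb functional; an optimizer is a $\psi\in\mathcal{M}_{\sigma,\xi}$ at which this infimum is attained. Then for every fixed pair $(\sigma,\xi)\in[-1,1]\times\mathbb{R}$ the function $\lambda\mapsto F_{\mathrm{LL}}^\lambda(\sigma,\xi)$ is concave on $\mathbb{R}$, and for every $\lambda\in\mathbb{R}$ there is a unique real-valued and strictly positive optimizer $\psi^\lambda\in\mathcal{M}_{\sigma,\xi}$ of $F_{\mathrm{LL}}^\lambda(\sigma,\xi)$, and $$g\,\langle\hat\sigma_z\hat x\rangle_{\psi^\lambda}\in\overline{\partial}_\lambda F_{\mathrm{LL}}^\lambda(\sigma,\xi)=\big\{f\in\mathbb{R} : F_{\mathrm{LL}}^{\lambda'}(\sigma,\xi)\le F_{\mathrm{LL}}^{\lambda}(\sigma,\xi)+f(\lambda'-\lambda)\ \text{for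 all }\lambda'\in\mathbb{R}\big\}.$$ Here strictly positive means that the continuous representatives of both $\psi_+$ and $\psi_-$ are positive at every point if $|\sigma|<1$; for $\sigma=\pm1$ the constraints force $\psi_\mp=0$, and strict positivity is required of $\psi_\pm$ only. -/

import Mathlib

open MeasureTheory

noncomputable section

namespace QRabi

/-- The Hilbert space `L²(ℝ, ℂ)`. -/
abbrev L2 : Type := Lp ℂ 2 (volume : Measure ℝ)

/-- The state space `ℂ² ⊗ L²(ℝ, ℂ) ≃ L²(ℝ, ℂ²)`: pairs `ψ = (ψ₊, ψ₋)`, written `(ψ.fst, ψ.snd)`, with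
the Hilbert norm `‖ψ‖² = ‖ψ₊‖² + ‖ψ₋‖²`. -/
abbrev State : Type := WithLp 2 (L2 × L2)

/-- `g ∈ L²` is the weak derivative of `f ∈ L²`. -/
def IsWeakDeriv (f g : L2) : Prop :=
  ∀ η : ℝ → ℝ, ContDiff ℝ (⊤ : ℕ∞) η → HasCompactSupport η →
    ∫ x, deriv η x • f x = - ∫ x, η x • g x

theorem IsWeakDeriv.unique {f g h : L2} (hg : IsWeakDeriv f g) (hh : IsWeakDeriv f h) :
    g = h := by
  have key (u : L2) : LocallyIntegrable (u : ℝ → ℂ) volume :=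
    (Lp.memLp u).locallyIntegrable (by norm_num)
  refine Lp.ext (ae_eq_of_integral_contDiff_smul_eq (key g) (key h) fun η h1 h2 => ?_)
  exact neg_injective ((hg η h1 h2).symm.trans (hh η h1 h2))

open Classical in
/-- The weak derivative `f'` of `f ∈ L²` (with value `0` if `f` has no weak derivative in `L²`). -/
def weakDeriv (f : L2) : L2 :=
  if h : ∃ g, IsWeakDeriv f g then h.choose else 0

theorem IsWeakDeriv.weakDeriv_eq {f g : L2} (h : IsWeakDeriv f g) : weakDeriv f = g := by
  have hex : ∃ g, IsWeakDeriv f g := ⟨g, h⟩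
  rw [weakDeriv, dif_pos hex]
  exact hex.choose_spec.unique h

/-- `‖p̂ f‖ < ∞` and `‖x̂ f‖ < ∞` for one component: `f` has a weak derivative in `L²`, and
`x ↦ x f(x)` is in `L²`. -/
def FiniteOscillatorEnergy (f : L2) : Prop :=
  (∃ g, IsWeakDeriv f g) ∧ MemLp (fun x : ℝ => (x : ℂ) * f x) 2 volume

/-- The space `Q₀` of admissible states (the form domain of `p̂² + ω² x̂²`). -/
def admissible : Set State :=
  {ψ | FiniteOscillatorEnergy ψ.fst ∧ FiniteOscillatorEnergy ψ.snd}

/-- `⟨p̂²⟩ = ‖p̂ ψ‖² = ∫ |ψ'|²`. -/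
def evPSq (ψ : State) : ℝ := ‖weakDeriv ψ.fst‖ ^ 2 + ‖weakDeriv ψ.snd‖ ^ 2

/-- `⟨x̂²⟩ = ∫ x² |ψ|²`. -/
def evXSq (ψ : State) : ℝ := ∫ x : ℝ, x ^ 2 * (‖ψ.fst x‖ ^ 2 + ‖ψ.snd x‖ ^ 2)

/-- The displacement `ξ_ψ = ⟨x̂⟩ = ∫ x |ψ|²`. -/
def evX (ψ : State) : ℝ := ∫ x : ℝ, x * (‖ψ.fst x‖ ^ 2 + ‖ψ.snd x‖ ^ 2)

/-- The polarization `σ_ψ = ⟨σ̂_z⟩ = ‖ψ₊‖² - ‖ψ₋‖²`. -/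
def evSigmaZ (ψ : State) : ℝ := ‖ψ.fst‖ ^ 2 - ‖ψ.snd‖ ^ 2

/-- `⟨σ̂_x⟩ = 2 Re ⟨ψ₊, ψ₋⟩`. -/
def evSigmaX (ψ : State) : ℝ := 2 * (inner ℂ ψ.fst ψ.snd).re

/-- `⟨σ̂_z x̂⟩ = ∫ x (|ψ₊|² - |ψ₋|²)`. -/
def evSigmaZX (ψ : State) : ℝ := ∫ x : ℝ, x * (‖ψ.fst x‖ ^ 2 - ‖ψ.snd x‖ ^ 2)

/-- The expectation value in `ψ` of the internal Hamiltonian with coupling scaled by `lam`,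
`Ĥ₀^lam = p̂²/2 + ω² x̂²/2 - t σ̂_x + lam g σ̂_z x̂`. -/
def internalEnergy (ω t g lam : ℝ) (ψ : State) : ℝ :=
  1 / 2 * evPSq ψ + ω ^ 2 / 2 * evXSq ψ - t * evSigmaX ψ + lam * g * evSigmaZX ψ

/-- The constraint manifold `M_{σ,ξ}`: normalized admissible states with polarization `σ` and
displacement `ξ`. -/
def constraintManifold (σ ξ : ℝ) : Set State :=
  {ψ | ψ ∈ admissible ∧ ‖ψ‖ = 1 ∧ evSigmaZ ψ = σ ∧ evX ψ = ξ}

/-- The Levy--Lieb functional `F_LL^lam(σ, ξ)`. -/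
def levyLieb (ω t g lam σ ξ : ℝ) : ℝ :=
  sInf (internalEnergy ω t g lam '' constraintManifold σ ξ)

/-- `ψ ∈ M_{σ,ξ}` is an optimizer: the infimum defining `F_LL^lam(σ, ξ)` is attained at `ψ`. -/
def IsOptimizer (ω t g lam σ ξ : ℝ) (ψ : State) : Prop :=
  ψ ∈ constraintManifold σ ξ ∧
    IsMinOn (internalEnergy ω t g lam) (constraintManifold σ ξ) ψ

/-- `f ∈ L²` is real-valued and strictly positive: it is represented by a continuous real function
that is positive at every point. (Elements of the form domain always have a continuous
representative.) -/
def StrictlyPositive (f : L2) : Prop :=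
  ∃ u : ℝ → ℝ, Continuous u ∧ (∀ x, 0 < u x) ∧ ∀ᵐ x, f x = (u x : ℂ)

/-- `ψ` is a real-valued and strictly positive optimizer. In `M_{σ,ξ}` one has
`‖ψ₊‖² = (1 + σ) / 2` and `‖ψ₋‖² = (1 - σ) / 2`, so `ψ₊ = 0` if `σ = -1` and `ψ₋ = 0` if `σ = 1`;
positivity is required of the components that do not vanish for this reason. -/
def IsPositiveOptimizer (ω t g lam σ ξ : ℝ) (ψ : State) : Prop :=
  IsOptimizer ω t g lam σ ξ ψ ∧
    (σ ≠ -1 → StrictlyPositive ψ.fst) ∧ (σ ≠ 1 → StrictlyPositive ψ.snd)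

/-- The superdifferential of `F : ℝ → ℝ` at `lam`. -/
def superdifferential (F : ℝ → ℝ) (lam : ℝ) : Set ℝ :=
  {f | ∀ lam' : ℝ, F lam' ≤ F lam + f * (lam' - lam)}

end QRabi

end

noncomputable section

namespace QRabi

open Set Filter Topology

/-! Replacing both components by their moduli preserves the constraints and the potential terms, and
raises neither the kinetic energy nor, since t ≥ 0, the tunnelling energy. So the problem concerns
real pairs (u, w) with squared norms (1 ± σ)/2 and displacement ξ (`exists_realEnergy_le`).

The displacement constraint can be dropped. Completing squares writes the energy as half of
`pairEnergy` (two oscillators with separate centres, coupled by tunnelling), plus a multiple of the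
displacement, plus a constant. With the centres of `exists_shifts`, translating a pair of
displacement X to displacement ξ gives the energy which `pairEnergy` predicts for displacement ξ,
lowered by ω²(X - ξ)²/2 (`exists_comp_add_realEnergy_le`). Hence it suffices to minimize
`pairEnergy` with the two norms prescribed.

A minimizer exists by the direct method: the confining potential prevents loss of norm along a
minimizing sequence, and the energy is lower semicontinuous (`exists_subseq_of_bounded_energy`,
`exists_pairEnergy_minimizer`). A nonnegative minimizer solves an Euler--Lagrange equation, so each
component of nonzero norm is positive by the strong minimum principle (`pos_of_minimizer`).
Uniqueness is convexity in the densities u², w²: the potential is linear in them, the tunnelling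
term is convex by Cauchy--Schwarz, and equality in the convexity of the kinetic energy forces
proportional components (`pairEnergy_minimizer_unique`).

Finally, the energy of a fixed state is affine in λ with slope g⟨σ_z x⟩. An infimum of affine
functions is concave, and the affine function of an optimizer at λ lies above it and touches it
there. -/

/-! ### Locally absolutely continuous functions. -/

theorem exists_subset_Ioo_of_hasCompactSupport {η : ℝ → ℝ} (hc : HasCompactSupport η) :
    ∃ R : ℝ, 0 < R ∧ tsupport η ⊆ Ioo (-R) R := by
  obtain ⟨R, hR⟩ := hc.isBounded.subset_closedBall 0
  refine ⟨|R| + 1, by positivity, fun x hx => ?_⟩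
  have := hR hx
  simp only [Metric.mem_closedBall, dist_zero_right, Real.norm_eq_abs] at this
  have h2 := abs_le.1 (this.trans (le_abs_self R))
  exact ⟨by linarith, by linarith⟩

/-- `u` is absolutely continuous on every compact interval. -/
def LocallyAC (u : ℝ → ℝ) : Prop := ∀ a b, AbsolutelyContinuousOnInterval u a b

namespace LocallyAC

variable {u w : ℝ → ℝ}

theorem continuous (hu : LocallyAC u) : Continuous u := by
  rw [continuous_iff_continuousAt]
  intro x
  have h := (hu (x - 1) (x + 1)).continuousOn
  rw [uIcc_of_le (by linarith)] at h
  exact h.continuousAt (Icc_mem_nhds (by linarith) (by linarith))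

theorem ae_differentiableAt (hu : LocallyAC u) : ∀ᵐ x, DifferentiableAt ℝ u x := by
  have h : ∀ n : ℕ, ∀ᵐ x, x ∈ uIcc (-(n : ℝ)) n → DifferentiableAt ℝ u x :=
    fun n => (hu _ _).ae_differentiableAt
  filter_upwards [ae_all_iff.2 h] with x hx
  obtain ⟨n, hn⟩ := exists_nat_ge |x|
  refine hx n ?_
  rw [uIcc_of_le (by linarith [abs_nonneg x])]
  exact abs_le.1 hn

theorem intervalIntegrable_deriv (hu : LocallyAC u) (a b : ℝ) :
    IntervalIntegrable (deriv u) volume a b :=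
  (hu a b).intervalIntegrable_deriv

theorem eq_add_integral (hu : LocallyAC u) (a x : ℝ) : u x = u a + ∫ s in a..x, deriv u s := by
  rw [(hu a x).integral_deriv_eq_sub]; ring

/-- The sums of increments in the definition of absolute continuity are dominated by K times those
of u and w. This serves both √(u² + w²) and the quotient of two functions. -/
theorem of_dist_le (hu : LocallyAC u) (hw : LocallyAC w) {h : ℝ → ℝ}
    (H : ∀ a b, ∃ K : ℝ, ∀ x ∈ uIcc a b, ∀ y ∈ uIcc a b,
      dist (h x) (h y) ≤ K * (dist (u x) (u y) + dist (w x) (w y))) : LocallyAC h := by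
  intro a b
  obtain ⟨K, hK⟩ := H a b
  have h1 := ((Filter.Tendsto.add (hu a b) (hw a b)).const_mul K)
  simp only [add_zero, mul_zero] at h1
  refine tendsto_of_tendsto_of_tendsto_of_le_of_le' tendsto_const_nhds h1
    (Eventually.of_forall fun E => Finset.sum_nonneg fun _ _ => dist_nonneg) ?_
  refine eventually_inf_principal.2 (Eventually.of_forall fun E hE => ?_)
  rw [← Finset.sum_add_distrib, Finset.mul_sum]
  exact Finset.sum_le_sum fun i hi => hK _ (hE.1 i hi).1 _ (hE.1 i hi).2

theorem add (hu : LocallyAC u) (hw : LocallyAC w) : LocallyAC fun x => u x + w x :=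
  fun a b => (hu a b).fun_add (hw a b)

theorem const_mul (hu : LocallyAC u) (r : ℝ) : LocallyAC fun x => r * u x :=
  fun a b => (hu a b).const_mul r

theorem of_contDiff (h : ContDiff ℝ 1 u) : LocallyAC u :=
  fun _ _ => h.contDiffOn.absolutelyContinuousOnInterval

theorem primitive {v : ℝ → ℝ} (hv : LocallyIntegrable v volume) (k : ℝ) :
    LocallyAC fun x => k + ∫ s in (0 : ℝ)..x, v s := by
  refine LocallyAC.add (u := fun _ => k) (of_contDiff contDiff_const) ?_
  intro a b
  have hi : ∀ p q, IntervalIntegrable v volume p q := fun p q =>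
    (hv.integrableOn_isCompact isCompact_uIcc).intervalIntegrable
  -- The interval is enlarged so that it contains the base point 0 of the primitive.
  have hab : uIcc a b ⊆ uIcc (min 0 (min a b)) (max 0 (max a b)) := by
    intro x hx
    simp only [uIcc, mem_Icc] at hx ⊢
    grind
  refine ((hi _ _).absolutelyContinuousOnInterval_intervalIntegral ?_).mono hab
  simp [uIcc, mem_Icc]

theorem deriv_primitive {v : ℝ → ℝ} (hv : LocallyIntegrable v volume) (k : ℝ) :
    deriv (fun x => k + ∫ s in (0 : ℝ)..x, v s) =ᵐ[volume] v := by
  filter_upwards [_root_.LocallyIntegrable.ae_hasDerivAt_integral hv] with x hx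
  exact ((hx 0).const_add k).deriv

/-- Integration by parts against a compactly supported smooth function. -/
theorem integral_deriv_mul (hu : LocallyAC u) {η : ℝ → ℝ} (hη : ContDiff ℝ (⊤ : ℕ∞) η)
    (hc : HasCompactSupport η) : ∫ x, deriv η x * u x = - ∫ x, η x * deriv u x := by
  obtain ⟨R, -, hR⟩ := exists_subset_Ioo_of_hasCompactSupport hc
  have hη1 : LocallyAC η := of_contDiff (hη.of_le (by exact_mod_cast le_top))
  have key := (hη1 (-R) R).integral_deriv_mul_eq_sub (hu (-R) R)
  have z : ∀ x, x ∉ Ioo (-R) R → η x = 0 := fun x hx => image_eq_zero_of_notMem_tsupport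
    fun h => hx (hR h)
  have z' : ∀ x, x ∉ Ioo (-R) R → deriv η x = 0 := fun x hx =>
    image_eq_zero_of_notMem_tsupport fun h => hx (hR (tsupport_deriv_subset h))
  have e1 : ∫ x, deriv η x * u x = ∫ x in (-R)..R, deriv η x * u x := by
    rw [intervalIntegral.integral_eq_integral_of_support_subset]
    intro x hx
    by_contra h
    exact hx (by simp [z' x fun h' => h (Ioo_subset_Ioc_self h')])
  have e2 : ∫ x, η x * deriv u x = ∫ x in (-R)..R, η x * deriv u x := by
    rw [intervalIntegral.integral_eq_integral_of_support_subset]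
    intro x hx
    by_contra h
    exact hx (by simp [z x fun h' => h (Ioo_subset_Ioc_self h')])
  rw [e1, e2, eq_neg_iff_add_eq_zero, ← intervalIntegral.integral_add, key, z R (by simp),
    z (-R) (by simp)]
  · ring
  · exact (hη1.intervalIntegrable_deriv _ _).mul_continuousOn hu.continuous.continuousOn
  · exact (hu.intervalIntegrable_deriv _ _).continuousOn_mul hη1.continuous.continuousOn

end LocallyAC

/-! ### The real form domain. -/

/-- A real function with `u, u', x u ∈ L²`, given by its absolutely continuous representative. -/
structure OscDomain (u : ℝ → ℝ) : Prop where
  ac : LocallyAC u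
  memLp : MemLp u 2 volume
  deriv_memLp : MemLp (deriv u) 2 volume
  mul_memLp : MemLp (fun x => x * u x) 2 volume

namespace OscDomain

variable {u w : ℝ → ℝ}

theorem continuous (hu : OscDomain u) : Continuous u := hu.ac.continuous

theorem deriv_add (hu : OscDomain u) (hw : OscDomain w) :
    deriv (fun x => u x + w x) =ᵐ[volume] fun x => deriv u x + deriv w x := by
  filter_upwards [hu.ac.ae_differentiableAt, hw.ac.ae_differentiableAt] with x h1 h2
  exact (h1.hasDerivAt.add h2.hasDerivAt).deriv

theorem add (hu : OscDomain u) (hw : OscDomain w) : OscDomain fun x => u x + w x where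
  ac := hu.ac.add hw.ac
  memLp := hu.memLp.add hw.memLp
  deriv_memLp := (memLp_congr_ae (hu.deriv_add hw)).2 (hu.deriv_memLp.add hw.deriv_memLp)
  mul_memLp := by
    simp only [mul_add]
    exact hu.mul_memLp.add hw.mul_memLp

theorem const_mul (hu : OscDomain u) (r : ℝ) : OscDomain fun x => r * u x where
  ac := hu.ac.const_mul r
  memLp := hu.memLp.const_mul r
  deriv_memLp := by
    have h : deriv (fun x => r * u x) = fun x => r * deriv u x := by
      ext x; exact deriv_const_mul_field r
    rw [h]
    exact hu.deriv_memLp.const_mul r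
  mul_memLp := by
    convert! hu.mul_memLp.const_mul r using 2
    ring

theorem zero : OscDomain fun _ => 0 where
  ac := .of_contDiff contDiff_const
  memLp := MemLp.zero
  deriv_memLp := by simp
  mul_memLp := by simp

theorem of_hasCompactSupport {η : ℝ → ℝ} (hη : ContDiff ℝ (⊤ : ℕ∞) η)
    (hc : HasCompactSupport η) : OscDomain η where
  ac := .of_contDiff (hη.of_le (by exact_mod_cast le_top))
  memLp := hη.continuous.memLp_of_hasCompactSupport hc
  deriv_memLp := (hη.continuous_deriv (by simp)).memLp_of_hasCompactSupport hc.deriv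
  mul_memLp := (continuous_id.mul hη.continuous).memLp_of_hasCompactSupport hc.mul_left

theorem comp_add (hu : OscDomain u) (s : ℝ) : OscDomain fun x => u (x + s) where
  ac := by
    have h : (fun x => u (x + s)) = fun x => u s + ∫ y in (0 : ℝ)..x, deriv u (y + s) := by
      ext x
      rw [intervalIntegral.integral_comp_add_right, zero_add]
      exact hu.ac.eq_add_integral s _
    rw [h]
    refine LocallyAC.primitive ?_ _
    exact ((hu.deriv_memLp.comp_measurePreserving
      (measurePreserving_add_right volume s)).locallyIntegrable (by norm_num))
  memLp := hu.memLp.comp_measurePreserving (measurePreserving_add_right volume s)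
  deriv_memLp := by
    have h : deriv (fun x => u (x + s)) = deriv u ∘ fun x => x + s := by
      ext x; exact deriv_comp_add_const u s x
    rw [h]
    exact hu.deriv_memLp.comp_measurePreserving (measurePreserving_add_right volume s)
  mul_memLp := by
    have h1 := (hu.mul_memLp.sub (hu.memLp.const_mul s)).comp_measurePreserving
      (measurePreserving_add_right volume s)
    convert! h1 using 2
    simp; ring

theorem shift_memLp (hu : OscDomain u) (c : ℝ) : MemLp (fun x => (x + c) * u x) 2 volume := by
  convert! hu.mul_memLp.add (hu.memLp.const_mul c) using 2
  simp [add_mul]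

end OscDomain

/-! ### The modulus √(u² + w²) and its kinetic energy. -/

/-- Norms of derivatives: if `h` is dominated by `(u, w)` in the sense of differences, then
`|h'|² ≤ u'² + w'²`. -/
theorem abs_deriv_le_of_dist_le {u w h : ℝ → ℝ} {x : ℝ} (hu : DifferentiableAt ℝ u x)
    (hw : DifferentiableAt ℝ w x) (hh : DifferentiableAt ℝ h x)
    (H : ∀ y, (h y - h x) ^ 2 ≤ (u y - u x) ^ 2 + (w y - w x) ^ 2) :
    deriv h x ^ 2 ≤ deriv u x ^ 2 + deriv w x ^ 2 := by
  have t1 := hasDerivAt_iff_tendsto_slope.1 hu.hasDerivAt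
  have t2 := hasDerivAt_iff_tendsto_slope.1 hw.hasDerivAt
  have t3 := hasDerivAt_iff_tendsto_slope.1 hh.hasDerivAt
  refine le_of_tendsto_of_tendsto (t3.pow 2) ((t1.pow 2).add (t2.pow 2)) (Eventually.of_forall ?_)
  intro y
  simp only [slope, vsub_eq_sub, smul_eq_mul, mul_pow, ← mul_add]
  exact mul_le_mul_of_nonneg_left (H y) (by positivity)

/-- Reverse triangle inequality for the Euclidean norm of the plane vectors (u, w). -/
theorem norm_dist_sq_le (u w : ℝ → ℝ) (x y : ℝ) :
    (√(u y ^ 2 + w y ^ 2) - √(u x ^ 2 + w x ^ 2)) ^ 2 ≤ (u y - u x) ^ 2 + (w y - w x) ^ 2 := by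
  have h1 := Real.sq_sqrt (by positivity : 0 ≤ u y ^ 2 + w y ^ 2)
  have h2 := Real.sq_sqrt (by positivity : 0 ≤ u x ^ 2 + w x ^ 2)
  have h3 : u y * u x + w y * w x ≤ √(u y ^ 2 + w y ^ 2) * √(u x ^ 2 + w x ^ 2) := by
    rw [← Real.sqrt_mul (by positivity)]
    refine Real.le_sqrt_of_sq_le ?_
    nlinarith [sq_nonneg (u y * w x - w y * u x)]
  nlinarith

theorem LocallyAC.sqrt_add_sq {u w : ℝ → ℝ} (hu : LocallyAC u) (hw : LocallyAC w) :
    LocallyAC fun x => √(u x ^ 2 + w x ^ 2) := by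
  refine hu.of_dist_le hw fun a b => ⟨1, fun x _ y _ => ?_⟩
  have h := norm_dist_sq_le u w y x
  rw [one_mul, Real.dist_eq, Real.dist_eq, Real.dist_eq]
  refine abs_le_of_sq_le_sq (h.trans ?_) (by positivity)
  nlinarith [abs_nonneg (u x - u y), abs_nonneg (w x - w y), sq_abs (u x - u y),
    sq_abs (w x - w y), mul_nonneg (abs_nonneg (u x - u y)) (abs_nonneg (w x - w y))]

theorem LocallyAC.deriv_sqrt_add_sq_le {u w : ℝ → ℝ} (hu : LocallyAC u) (hw : LocallyAC w) :
    ∀ᵐ x, deriv (fun x => √(u x ^ 2 + w x ^ 2)) x ^ 2 ≤ deriv u x ^ 2 + deriv w x ^ 2 := by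
  filter_upwards [hu.ae_differentiableAt, hw.ae_differentiableAt,
    (hu.sqrt_add_sq hw).ae_differentiableAt] with x h1 h2 h3
  exact abs_deriv_le_of_dist_le h1 h2 h3 fun y => norm_dist_sq_le u w x y

theorem memLp_of_sq_le {f g h : ℝ → ℝ} (hf : AEStronglyMeasurable f volume)
    (hg : MemLp g 2 volume) (hh : MemLp h 2 volume) (H : ∀ᵐ x, f x ^ 2 ≤ g x ^ 2 + h x ^ 2) :
    MemLp f 2 volume := by
  rw [memLp_two_iff_integrable_sq hf]
  refine (hg.integrable_sq.add hh.integrable_sq).mono' (hf.pow 2) ?_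
  filter_upwards [H] with x hx
  simpa using hx

theorem OscDomain.sqrt_add_sq {u w : ℝ → ℝ} (hu : OscDomain u) (hw : OscDomain w) :
    OscDomain fun x => √(u x ^ 2 + w x ^ 2) where
  ac := hu.ac.sqrt_add_sq hw.ac
  memLp := memLp_of_sq_le (hu.ac.sqrt_add_sq hw.ac).continuous.aestronglyMeasurable hu.memLp
    hw.memLp (Eventually.of_forall fun x => (Real.sq_sqrt (by positivity)).le)
  deriv_memLp := memLp_of_sq_le (measurable_deriv _).aestronglyMeasurable hu.deriv_memLp
    hw.deriv_memLp (hu.ac.deriv_sqrt_add_sq_le hw.ac)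
  mul_memLp := by
    refine memLp_of_sq_le (continuous_id.mul
      (hu.ac.sqrt_add_sq hw.ac).continuous).aestronglyMeasurable hu.mul_memLp hw.mul_memLp
      (Eventually.of_forall fun x => ?_)
    simp only [mul_pow]
    rw [Real.sq_sqrt (by positivity), mul_add]

theorem integral_deriv_sqrt_add_sq_le {u w : ℝ → ℝ} (hu : OscDomain u) (hw : OscDomain w) :
    ∫ x, deriv (fun x => √(u x ^ 2 + w x ^ 2)) x ^ 2 ≤
      (∫ x, deriv u x ^ 2) + ∫ x, deriv w x ^ 2 := by
  rw [← integral_add hu.deriv_memLp.integrable_sq hw.deriv_memLp.integrable_sq]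
  exact integral_mono_ae (hu.sqrt_add_sq hw).deriv_memLp.integrable_sq
    (hu.deriv_memLp.integrable_sq.add hw.deriv_memLp.integrable_sq)
    (hu.ac.deriv_sqrt_add_sq_le hw.ac)

/-! ### Weak derivatives and absolutely continuous representatives. -/

/-- A test function with vanishing integral is the derivative of a test function. -/
theorem exists_deriv_eq_of_integral_eq_zero {θ : ℝ → ℝ} (hθ : ContDiff ℝ (⊤ : ℕ∞) θ)
    (hc : HasCompactSupport θ) (h0 : ∫ x, θ x = 0) :
    ∃ Θ : ℝ → ℝ, ContDiff ℝ (⊤ : ℕ∞) Θ ∧ HasCompactSupport Θ ∧ deriv Θ = θ := by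
  obtain ⟨R, -, hR⟩ := exists_subset_Ioo_of_hasCompactSupport hc
  have z : ∀ x, x ∉ Ioo (-R) R → θ x = 0 := fun x hx => image_eq_zero_of_notMem_tsupport
    fun h => hx (hR h)
  have hd : deriv (fun x => ∫ s in (-R)..x, θ s) = θ := by
    ext x
    exact hθ.continuous.deriv_integral _ _ _
  refine ⟨fun x => ∫ s in (-R)..x, θ s, ?_, ?_, hd⟩
  · refine contDiff_infty_iff_deriv.2 ⟨fun x => ?_, by rw [hd]; exact hθ⟩
    exact (hθ.continuous.integral_hasStrictDerivAt _ _).hasDerivAt.differentiableAt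
  · refine HasCompactSupport.intro (isCompact_Icc (a := -R) (b := R)) fun x hx => ?_
    rcases lt_or_ge x (-R) with h | h
    · refine intervalIntegral.integral_zero_ae (Eventually.of_forall fun s hs => z s fun h' => ?_)
      rw [uIoc_of_ge h.le] at hs
      linarith [hs.2, h'.1]
    · have hx' : R < x := by
        by_contra h'
        exact hx ⟨h, not_lt.1 h'⟩
      rw [intervalIntegral.integral_eq_integral_of_support_subset, h0]
      intro s hs
      by_contra h'
      refine hs (z s fun h'' => h' ⟨h''.1, by linarith [h''.2]⟩)

theorem integrable_test_mul {η f : ℝ → ℝ} (hη : Continuous η) (hc : HasCompactSupport η)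
    (hf : LocallyIntegrable f volume) : Integrable (fun x => η x * f x) := by
  simpa using hf.integrable_smul_left_of_hasCompactSupport hη hc

/-- Du Bois-Reymond lemma: subtracting from η its integral times a bump η₀ of integral one leaves
the derivative of a test function, so f pairs with η as the constant ∫ η₀ f does. -/
theorem ae_eq_const_of_integral_deriv_mul_eq_zero {f : ℝ → ℝ} (hf : LocallyIntegrable f volume)
    (h : ∀ η : ℝ → ℝ, ContDiff ℝ (⊤ : ℕ∞) η → HasCompactSupport η → ∫ x, deriv η x * f x = 0) :
    ∃ k, ∀ᵐ x, f x = k := by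
  let b : ContDiffBump (0 : ℝ) := default
  set η₀ : ℝ → ℝ := b.normed volume with hη₀
  have s0 : ContDiff ℝ (⊤ : ℕ∞) η₀ := b.contDiff_normed
  have c0 : HasCompactSupport η₀ := b.hasCompactSupport_normed
  have i0 : ∫ x, η₀ x = 1 := b.integral_normed
  refine ⟨∫ x, η₀ x * f x, ?_⟩
  refine ae_eq_of_integral_contDiff_smul_eq hf (locallyIntegrable_const _) fun η s1 c1 => ?_
  set I := ∫ x, η x
  obtain ⟨Θ, s2, c2, hΘ⟩ := exists_deriv_eq_of_integral_eq_zero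
    (θ := fun x => η x - I * η₀ x) (s1.sub (contDiff_const.mul s0)) (c1.sub c0.mul_left) (by
      rw [integral_sub (s1.continuous.integrable_of_hasCompactSupport c1)
        ((s0.continuous.integrable_of_hasCompactSupport c0).const_mul I), integral_const_mul, i0]
      simp [I])
  have h2 := h Θ s2 c2
  rw [hΘ] at h2
  simp only [sub_mul, mul_assoc] at h2
  rw [integral_sub (integrable_test_mul s1.continuous c1 hf)
    ((integrable_test_mul s0.continuous c0 hf).const_mul I), integral_const_mul, sub_eq_zero] at h2
  simp only [smul_eq_mul]
  rw [h2, integral_mul_const]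

/-- A locally integrable function with locally integrable weak derivative `g` is a primitive of
`g` almost everywhere. -/
theorem ae_eq_add_integral_of_weak_deriv {f g : ℝ → ℝ} (hf : LocallyIntegrable f volume)
    (hg : LocallyIntegrable g volume)
    (h : ∀ η : ℝ → ℝ, ContDiff ℝ (⊤ : ℕ∞) η → HasCompactSupport η →
      ∫ x, deriv η x * f x = - ∫ x, η x * g x) :
    ∃ k, ∀ᵐ x, f x = k + ∫ s in (0 : ℝ)..x, g s := by
  have hG := LocallyAC.primitive hg 0
  obtain ⟨k, hk⟩ := ae_eq_const_of_integral_deriv_mul_eq_zero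
    (hf.sub hG.continuous.locallyIntegrable) (fun η s c => by
      have hc := s.continuous_deriv (by simp)
      simp only [Pi.sub_apply, mul_sub]
      rw [integral_sub (integrable_test_mul hc c.deriv hf)
        (integrable_test_mul hc c.deriv hG.continuous.locallyIntegrable), h η s c,
        hG.integral_deriv_mul s c, sub_neg_eq_add, neg_add_eq_zero]
      refine integral_congr_ae ?_
      filter_upwards [LocallyAC.deriv_primitive hg 0] with x hx
      rw [hx])
  refine ⟨k, ?_⟩
  filter_upwards [hk] with x hx
  simp only [Pi.sub_apply, zero_add] at hx
  rw [← hx]; ring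

theorem OscDomain.of_weak_deriv {f g : ℝ → ℝ} (hf : MemLp f 2 volume) (hg : MemLp g 2 volume)
    (hx : MemLp (fun x => x * f x) 2 volume)
    (h : ∀ η : ℝ → ℝ, ContDiff ℝ (⊤ : ℕ∞) η → HasCompactSupport η →
      ∫ x, deriv η x * f x = - ∫ x, η x * g x) :
    ∃ u, OscDomain u ∧ f =ᵐ[volume] u ∧ deriv u =ᵐ[volume] g := by
  have hg' := hg.locallyIntegrable (by norm_num)
  obtain ⟨k, hk⟩ := ae_eq_add_integral_of_weak_deriv (hf.locallyIntegrable (by norm_num)) hg' h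
  refine ⟨fun x => k + ∫ s in (0 : ℝ)..x, g s, ⟨.primitive hg' k, ?_, ?_, ?_⟩, hk,
    LocallyAC.deriv_primitive hg' k⟩
  · exact (memLp_congr_ae hk).1 hf
  · exact (memLp_congr_ae (LocallyAC.deriv_primitive hg' k)).2 hg
  · refine (memLp_congr_ae ?_).1 hx
    filter_upwards [hk] with x hx
    rw [hx]

theorem L2.norm_sq_eq_integral (f : L2) : ‖f‖ ^ 2 = ∫ x, ‖f x‖ ^ 2 := by
  rw [← inner_self_eq_norm_sq (𝕜 := ℂ), MeasureTheory.L2.inner_def,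
    ← integral_re (MeasureTheory.L2.integrable_inner _ _)]
  simp only [inner_self_eq_norm_sq]

/-- The modulus of a component of finite energy is in the real form domain, and its kinetic energy
is not larger. -/
theorem FiniteOscillatorEnergy.exists_norm_eq {f : L2} (hf : FiniteOscillatorEnergy f) :
    ∃ u : ℝ → ℝ, OscDomain u ∧ (∀ x, 0 ≤ u x) ∧ (∀ᵐ x, ‖f x‖ = u x) ∧
      ∫ x, deriv u x ^ 2 ≤ ‖weakDeriv f‖ ^ 2 := by
  obtain ⟨⟨g, hg⟩, hx⟩ := hf
  rw [hg.weakDeriv_eq]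
  have int : ∀ (u : L2) (η : ℝ → ℝ), Continuous η → HasCompactSupport η →
      Integrable (fun x => η x • u x) := fun u η h1 h2 =>
    ((Lp.memLp u).locallyIntegrable (by norm_num)).integrable_smul_left_of_hasCompactSupport h1 h2
  obtain ⟨r, hr, fr, gr⟩ := OscDomain.of_weak_deriv (f := fun x => (f x).re)
    (g := fun x => (g x).re) (Lp.memLp f).re (Lp.memLp g).re
    (by simpa using hx.re) (fun η s c => by
      have h1 := congrArg Complex.re (hg η s c)
      have e1 := integral_re (𝕜 := ℂ) (int f _ (s.continuous_deriv (by simp)) c.deriv)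
      have e2 := integral_re (𝕜 := ℂ) (int g _ s.continuous c)
      simp only [RCLike.re_to_complex, Complex.real_smul, Complex.mul_re, Complex.ofReal_re,
        Complex.ofReal_im, zero_mul, sub_zero] at e1 e2
      rw [e1, e2, ← Complex.neg_re]
      simpa only [Complex.real_smul] using h1)
  obtain ⟨j, hj, fj, gj⟩ := OscDomain.of_weak_deriv (f := fun x => (f x).im)
    (g := fun x => (g x).im) (Lp.memLp f).im (Lp.memLp g).im
    (by simpa using hx.im) (fun η s c => by
      have h1 := congrArg Complex.im (hg η s c)
      have e1 := integral_im (𝕜 := ℂ) (int f _ (s.continuous_deriv (by simp)) c.deriv)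
      have e2 := integral_im (𝕜 := ℂ) (int g _ s.continuous c)
      simp only [RCLike.im_to_complex, Complex.real_smul, Complex.mul_im, Complex.ofReal_re,
        Complex.ofReal_im, zero_mul, add_zero] at e1 e2
      rw [e1, e2, ← Complex.neg_im]
      simpa only [Complex.real_smul] using h1)
  refine ⟨_, hr.sqrt_add_sq hj, fun x => Real.sqrt_nonneg _, ?_,
    (integral_deriv_sqrt_add_sq_le hr hj).trans ?_⟩
  · filter_upwards [fr, fj] with x h1 h2
    rw [← h1, ← h2, Complex.norm_def, Complex.normSq_apply]
    ring_nf
  · rw [← integral_add hr.deriv_memLp.integrable_sq hj.deriv_memLp.integrable_sq,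
      L2.norm_sq_eq_integral]
    refine (integral_congr_ae ?_).le
    filter_upwards [gr, gj] with x h1 h2
    rw [h1, h2, Complex.sq_norm, Complex.normSq_apply]
    ring

/-! ### Compactness of sequences of bounded energy. -/

/-- Bounded sequences in a separable Hilbert space have weakly convergent subsequences. -/
theorem exists_weak_subseq {H : Type*} [NormedAddCommGroup H] [InnerProductSpace ℝ H]
    [CompleteSpace H] [TopologicalSpace.SeparableSpace H] (f : ℕ → H) (C : ℝ)
    (hC : ∀ n, ‖f n‖ ≤ C) :
    ∃ φ : ℕ → ℕ, StrictMono φ ∧ ∃ f₀ : H, ∀ g : H,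
      Tendsto (fun n => inner ℝ (f (φ n)) g) atTop (𝓝 (inner ℝ f₀ g)) := by
  obtain ⟨l, -, φ, hφ, hl⟩ := WeakDual.isSeqCompact_closedBall ℝ H 0 C
    (x := fun n => StrongDual.toWeakDual (InnerProductSpace.toDual ℝ H (f n)))
    (fun n => by simpa using hC n)
  refine ⟨φ, hφ, (InnerProductSpace.toDual ℝ H).symm (WeakDual.toStrongDual l), fun g => ?_⟩
  have h := (WeakBilin.eval_continuous (topDualPairing ℝ H) g).continuousAt.tendsto.comp hl
  rw [InnerProductSpace.toDual_symm_apply]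
  exact h

theorem integral_mul_toLp {f g : ℝ → ℝ} (hf : MemLp f 2 volume) (hg : MemLp g 2 volume) :
    inner ℝ (hf.toLp f) (hg.toLp g) = ∫ x, f x * g x := by
  rw [MeasureTheory.L2.inner_def]
  refine integral_congr_ae ?_
  filter_upwards [hf.coeFn_toLp, hg.coeFn_toLp] with x h1 h2
  rw [h1, h2]
  simp [mul_comm]

theorem exists_weak_subseq_memLp (v : ℕ → ℝ → ℝ) (C : ℝ) (hv : ∀ n, MemLp (v n) 2 volume)
    (hC : ∀ n, ∫ x, v n x ^ 2 ≤ C) :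
    ∃ φ : ℕ → ℕ, StrictMono φ ∧ ∃ v₀ : ℝ → ℝ, MemLp v₀ 2 volume ∧ ∀ g, MemLp g 2 volume →
      Tendsto (fun n => ∫ x, v (φ n) x * g x) atTop (𝓝 (∫ x, v₀ x * g x)) := by
  have : Fact ((2 : ENNReal) ≠ ⊤) := ⟨by norm_num⟩
  obtain ⟨φ, hφ, f₀, h⟩ := exists_weak_subseq (fun n => (hv n).toLp (v n)) (√C) (fun n => by
    refine Real.le_sqrt_of_sq_le ?_
    rw [← real_inner_self_eq_norm_sq, integral_mul_toLp]
    simpa only [sq] using hC n)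
  refine ⟨φ, hφ, f₀, Lp.memLp f₀, fun g hg => ?_⟩
  have h2 := h (hg.toLp g)
  simp only [integral_mul_toLp] at h2
  rwa [← Lp.toLp_coeFn f₀ (Lp.memLp f₀), integral_mul_toLp] at h2

/-- Fatou's lemma for real integrals. -/
theorem integrable_and_integral_le_of_tendsto {F : ℕ → ℝ → ℝ} {f : ℝ → ℝ} {r : ℕ → ℝ} {s : ℝ}
    (hF : ∀ n, Integrable (F n)) (h0 : ∀ n x, 0 ≤ F n x) (hr : ∀ n, ∫ x, F n x ≤ r n)
    (hrs : Tendsto r atTop (𝓝 s)) (hf : ∀ x, Tendsto (fun n => F n x) atTop (𝓝 (f x))) :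
    Integrable f ∧ ∫ x, f x ≤ s := by
  have hm : AEStronglyMeasurable f volume :=
    aestronglyMeasurable_of_tendsto_ae atTop (fun n => (hF n).1) (Eventually.of_forall hf)
  have f0 : ∀ x, 0 ≤ f x := fun x => ge_of_tendsto' (hf x) fun n => h0 n x
  have s0 : 0 ≤ s := ge_of_tendsto' hrs fun n => (integral_nonneg (h0 n)).trans (hr n)
  have key : ∫⁻ x, ENNReal.ofReal (f x) ≤ ENNReal.ofReal s := by
    have e : ∀ x, ENNReal.ofReal (f x) = liminf (fun n => ENNReal.ofReal (F n x)) atTop :=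
      fun x => ((ENNReal.continuous_ofReal.tendsto _).comp (hf x)).liminf_eq.symm
    simp_rw [e]
    refine (lintegral_liminf_le' fun n => (hF n).1.aemeasurable.ennreal_ofReal).trans ?_
    rw [← ((ENNReal.continuous_ofReal.tendsto _).comp hrs).liminf_eq]
    refine liminf_le_liminf (Eventually.of_forall fun n => ?_)
    rw [← ofReal_integral_eq_lintegral_ofReal (hF n) (Eventually.of_forall (h0 n))]
    exact ENNReal.ofReal_le_ofReal (hr n)
  have hi : Integrable f := by
    refine ⟨hm, ?_⟩
    rw [hasFiniteIntegral_iff_ofReal (Eventually.of_forall f0)]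
    exact key.trans_lt ENNReal.ofReal_lt_top
  refine ⟨hi, ?_⟩
  rw [← ofReal_integral_eq_lintegral_ofReal hi (Eventually.of_forall f0)] at key
  exact (ENNReal.ofReal_le_ofReal_iff s0).1 key

theorem memLp_and_integral_sq_le_of_tendsto {F : ℕ → ℝ → ℝ} {f : ℝ → ℝ} {C : ℝ}
    (hF : ∀ n, MemLp (F n) 2 volume) (hr : ∀ n, ∫ x, F n x ^ 2 ≤ C)
    (hf : ∀ x, Tendsto (fun n => F n x) atTop (𝓝 (f x))) :
    MemLp f 2 volume ∧ ∫ x, f x ^ 2 ≤ C := by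
  have hm : AEStronglyMeasurable f volume :=
    aestronglyMeasurable_of_tendsto_ae atTop (fun n => (hF n).1) (Eventually.of_forall hf)
  have h := integrable_and_integral_le_of_tendsto (fun n => (hF n).integrable_sq)
    (fun n x => sq_nonneg _) hr tendsto_const_nhds (fun x => (hf x).pow 2)
  exact ⟨(memLp_two_iff_integrable_sq hm).2 h.1, h.2⟩

/-- Integrates |u'| ≤ (u'² + 1)/2. This is cruder than Cauchy--Schwarz, but only a locally bounded
estimate depending on C alone is needed. -/
theorem abs_sub_le_of_integral_deriv_sq_le {u : ℝ → ℝ} {C : ℝ} (hu : OscDomain u)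
    (hC : ∫ x, deriv u x ^ 2 ≤ C) (x y : ℝ) : |u x - u y| ≤ (C + |x - y|) / 2 := by
  have h : u x - u y = ∫ s in y..x, deriv u s := by rw [hu.ac.eq_add_integral y x]; ring
  have hi : IntegrableOn (fun s => (deriv u s ^ 2 + 1) / 2) (uIoc y x) :=
    ((hu.deriv_memLp.integrable_sq.integrableOn).add (integrableOn_const (by simp) )).div_const 2
  rw [h, ← Real.norm_eq_abs]
  refine (intervalIntegral.norm_integral_le_integral_norm_uIoc).trans ?_
  refine (setIntegral_mono_on (hu.ac.intervalIntegrable_deriv y x).def'.norm hi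
    measurableSet_uIoc (fun s _ => ?_)).trans ?_
  · rw [Real.norm_eq_abs]
    nlinarith [sq_abs (deriv u s), sq_nonneg (|deriv u s| - 1)]
  · rw [integral_div, integral_add hu.deriv_memLp.integrable_sq.integrableOn
      (integrableOn_const (by simp))]
    have h1 : ∫ s in uIoc y x, deriv u s ^ 2 ≤ C :=
      (setIntegral_le_integral hu.deriv_memLp.integrable_sq
        (Eventually.of_forall fun s => sq_nonneg _)).trans hC
    have h2 : ∫ s in uIoc y x, (1 : ℝ) = |x - y| := by
      simp [measureReal_def, Real.volume_uIoc]
    rw [h2]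
    gcongr

/-- Average |u 0| ≤ |u x| + |u 0 - u x| over x in [0, 1], with |u x| ≤ (u x² + 1)/2. -/
theorem abs_apply_zero_le {u : ℝ → ℝ} {a C : ℝ} (hu : OscDomain u) (ha : ∫ x, u x ^ 2 ≤ a)
    (hC : ∫ x, deriv u x ^ 2 ≤ C) : |u 0| ≤ (a + 1) / 2 + (C + 1) / 2 := by
  have hc : IntervalIntegrable (fun x => (u x ^ 2 + 1) / 2 + (C + 1) / 2) volume 0 1 :=
    Continuous.intervalIntegrable (by have := hu.continuous; fun_prop) _ _
  have hs : IntervalIntegrable (fun x => u x ^ 2) volume 0 1 :=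
    Continuous.intervalIntegrable (by have := hu.continuous; fun_prop) _ _
  have h := intervalIntegral.integral_mono_on (μ := volume) zero_le_one
    (intervalIntegrable_const (c := |u 0|)) hc (fun x hx => by
      have h1 := abs_sub_le_of_integral_deriv_sq_le hu hC 0 x
      have h2 : |(0 : ℝ) - x| ≤ 1 := by rw [zero_sub, abs_neg, abs_of_nonneg hx.1]; exact hx.2
      have h3 := abs_sub_abs_le_abs_sub (u 0) (u x)
      nlinarith [sq_abs (u x), sq_nonneg (|u x| - 1)])
  have e : ∫ x in (0 : ℝ)..1, u x ^ 2 ≤ a := by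
    rw [intervalIntegral.integral_of_le zero_le_one]
    exact (setIntegral_le_integral hu.memLp.integrable_sq
      (Eventually.of_forall fun s => sq_nonneg _)).trans ha
  rw [intervalIntegral.integral_add ((hs.add intervalIntegrable_const).div_const 2)
    intervalIntegrable_const, intervalIntegral.integral_div,
    intervalIntegral.integral_add hs intervalIntegrable_const] at h
  simp at h
  linarith

/-- Compactness: a sequence of fixed norm with bounded oscillator energy has a subsequence which
converges pointwise, without loss of norm, and whose derivatives converge weakly. -/
theorem exists_subseq_of_bounded_energy {u : ℕ → ℝ → ℝ} {a C c : ℝ} (hu : ∀ n, OscDomain (u n))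
    (ha : ∀ n, ∫ x, u n x ^ 2 = a) (hk : ∀ n, ∫ x, deriv (u n) x ^ 2 ≤ C)
    (hp : ∀ n, ∫ x, ((x + c) * u n x) ^ 2 ≤ C) :
    ∃ φ : ℕ → ℕ, StrictMono φ ∧ ∃ w, OscDomain w ∧ ∫ x, w x ^ 2 = a ∧
      (∀ x, Tendsto (fun n => u (φ n) x) atTop (𝓝 (w x))) ∧
      Tendsto (fun n => ∫ x, deriv (u (φ n)) x * deriv w x) atTop (𝓝 (∫ x, deriv w x ^ 2)) := by
  obtain ⟨φ₁, hφ₁, v, hv, hvt⟩ := exists_weak_subseq_memLp (fun n => deriv (u n)) C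
    (fun n => (hu n).deriv_memLp) hk
  have hb0 : ∀ n, |u n 0| ≤ (a + 1) / 2 + (C + 1) / 2 := fun n =>
    abs_apply_zero_le (hu n) (ha n).le (hk n)
  obtain ⟨k, -, φ₂, hφ₂, hk0⟩ := tendsto_subseq_of_bounded
    (Metric.isBounded_closedBall (x := (0 : ℝ)) (r := (a + 1) / 2 + (C + 1) / 2))
    (x := fun n => u (φ₁ n) 0) (fun n => by simpa using hb0 _)
  have hvl := hv.locallyIntegrable (by norm_num)
  set w : ℝ → ℝ := fun x => k + ∫ s in (0 : ℝ)..x, v s with hw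
  have hwac : LocallyAC w := LocallyAC.primitive hvl k
  have hwd : deriv w =ᵐ[volume] v := LocallyAC.deriv_primitive hvl k
  set φ := φ₁ ∘ φ₂
  have hvt' : ∀ g, MemLp g 2 volume →
      Tendsto (fun n => ∫ x, deriv (u (φ n)) x * g x) atTop (𝓝 (∫ x, v x * g x)) :=
    fun g hg => (hvt g hg).comp hφ₂.tendsto_atTop
  -- Testing the weak convergence of derivatives against indicators of intervals gives convergence
  -- of their primitives; with convergence at 0 this is pointwise convergence.
  have ind : ∀ (p q : ℝ) (h : ℝ → ℝ),
      ∫ x, h x * (Ioc p q).indicator (fun _ => (1 : ℝ)) x = ∫ x in Ioc p q, h x := by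
    intro p q h
    rw [← integral_indicator measurableSet_Ioc]
    congr 1; ext x; by_cases hx : x ∈ Ioc p q <;> simp [hx]
  have hI : ∀ p q : ℝ, Tendsto (fun n => ∫ x in Ioc p q, deriv (u (φ n)) x) atTop
      (𝓝 (∫ x in Ioc p q, v x)) := by
    intro p q
    have h := hvt' ((Ioc p q).indicator fun _ => (1 : ℝ))
      (memLp_indicator_const 2 measurableSet_Ioc 1 (Or.inr (by simp)))
    simpa only [ind] using h
  have hpt : ∀ x, Tendsto (fun n => u (φ n) x) atTop (𝓝 (w x)) := by
    intro x
    have h1 : ∀ n, u (φ n) x = u (φ n) 0 + ∫ s in (0 : ℝ)..x, deriv (u (φ n)) s :=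
      fun n => (hu _).ac.eq_add_integral 0 x
    simp only [h1, hw]
    exact hk0.add ((hI 0 x).sub (hI x 0))
  have hw2 := memLp_and_integral_sq_le_of_tendsto (fun n => (hu (φ n)).memLp)
    (fun n => (ha (φ n)).le) hpt
  have hxw := memLp_and_integral_sq_le_of_tendsto (fun n => (hu (φ n)).shift_memLp c)
    (fun n => hp (φ n)) (fun x => (hpt x).const_mul (x + c))
  have hwdom : OscDomain w := by
    refine ⟨hwac, hw2.1, (memLp_congr_ae hwd).2 hv, ?_⟩
    convert! hxw.1.sub (hw2.1.const_mul c) using 2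
    simp; ring
  refine ⟨φ, hφ₁.comp hφ₂, w, hwdom, le_antisymm hw2.2 ?_, hpt, ?_⟩
  -- No mass escapes: by Chebyshev at most C / R² lies outside the interval of radius R about -c,
  -- and on that interval dominated convergence applies.
  · have tight : ∀ R : ℝ, 0 < R → a ≤ (∫ x, w x ^ 2) + C / R ^ 2 := by
      intro R hR
      set S : Set ℝ := Icc (-R - c) (R - c)
      have hn : ∀ n, a ≤ (∫ x in S, u (φ n) x ^ 2) + C / R ^ 2 := by
        intro n
        have i1 := (hu (φ n)).memLp.integrable_sq
        have i2 := ((hu (φ n)).shift_memLp c).integrable_sq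
        calc a = ∫ x, u (φ n) x ^ 2 := (ha _).symm
          _ ≤ ∫ x, (S.indicator (fun x => u (φ n) x ^ 2) x + ((x + c) * u (φ n) x) ^ 2 / R ^ 2) := by
              refine integral_mono i1 ((i1.indicator measurableSet_Icc).add (i2.div_const _))
                fun x => ?_
              by_cases hx : x ∈ S
              · simp only [indicator_of_mem hx]
                exact le_add_of_nonneg_right (by positivity)
              · simp only [indicator_of_notMem hx, zero_add]
                rw [le_div_iff₀ (by positivity), mul_pow, mul_comm]
                refine mul_le_mul_of_nonneg_right ?_ (sq_nonneg _)
                have : ¬ |x + c| ≤ R := fun h => hx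
                  ⟨by linarith [(abs_le.1 h).1], by linarith [(abs_le.1 h).2]⟩
                exact (sq_le_sq.2 (by rw [abs_of_pos hR]; exact (not_le.1 this).le))
          _ ≤ _ := by
              rw [integral_add (i1.indicator measurableSet_Icc) (i2.div_const _),
                integral_indicator measurableSet_Icc, integral_div]
              gcongr
              exact hp _
      have hlim : Tendsto (fun n => ∫ x in S, u (φ n) x ^ 2) atTop (𝓝 (∫ x in S, w x ^ 2)) := by
        refine tendsto_integral_of_dominated_convergence
          (fun x => ((a + 1) / 2 + (C + 1) / 2 + (C + |x|) / 2) ^ 2) (fun n =>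
            ((hu _).continuous.pow 2).aestronglyMeasurable)
          (Continuous.integrableOn_Icc (by fun_prop)) (fun n => ?_)
          (Eventually.of_forall fun x => (hpt x).pow 2)
        refine Eventually.of_forall fun x => ?_
        rw [norm_pow, Real.norm_eq_abs]
        refine pow_le_pow_left₀ (abs_nonneg _) ?_ 2
        have h1 := abs_sub_le_of_integral_deriv_sq_le (hu (φ n)) (hk _) x 0
        have h2 := abs_sub_abs_le_abs_sub (u (φ n) x) (u (φ n) 0)
        rw [sub_zero] at h1
        linarith [hb0 (φ n)]
      have h3 : a ≤ (∫ x in S, w x ^ 2) + C / R ^ 2 := ge_of_tendsto' (hlim.add_const _) hn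
      have h4 : ∫ x in S, w x ^ 2 ≤ ∫ x, w x ^ 2 := setIntegral_le_integral hw2.1.integrable_sq
        (Eventually.of_forall fun s => sq_nonneg _)
      linarith
    have hlim : Tendsto (fun R : ℝ => (∫ x, w x ^ 2) + C / R ^ 2) atTop
        (𝓝 ((∫ x, w x ^ 2) + 0)) :=
      tendsto_const_nhds.add (tendsto_const_nhds.div_atTop (tendsto_pow_atTop (by norm_num)))
    rw [add_zero] at hlim
    exact ge_of_tendsto hlim ((eventually_gt_atTop 0).mono tight)
  · have h := hvt' (deriv w) hwdom.deriv_memLp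
    convert! h using 2
    refine integral_congr_ae ?_
    filter_upwards [hwd] with x hx
    rw [hx]; ring

/-! ### Existence of a minimizer of the pair energy. -/

section

/-- Twice the energy of `u` in the oscillator `p²/2 + ω² (x + c)²/2`. -/
def oscEnergy (ω c : ℝ) (u : ℝ → ℝ) : ℝ :=
  (∫ x, deriv u x ^ 2) + ω ^ 2 * ∫ x, ((x + c) * u x) ^ 2

/-- Twice the energy of two oscillators, centred at `-c` and `-d`, with tunnelling `t`. -/
def pairEnergy (ω t c d : ℝ) (u w : ℝ → ℝ) : ℝ :=
  oscEnergy ω c u + oscEnergy ω d w - 4 * t * ∫ x, u x * w x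

/-- The nonnegative potential part of `pairEnergy`. -/
def pairPotential (ω t c d : ℝ) (u w : ℝ → ℝ) (x : ℝ) : ℝ :=
  ω ^ 2 * ((x + c) * u x) ^ 2 + ω ^ 2 * ((x + d) * w x) ^ 2 + 2 * t * (u x - w x) ^ 2

theorem integrable_mul_of_memLp {f g : ℝ → ℝ} (hf : MemLp f 2 volume) (hg : MemLp g 2 volume) :
    Integrable fun x => f x * g x :=
  hf.integrable_mul hg

variable {ω t c d a b : ℝ} {u w : ℝ → ℝ}

theorem pairPotential_nonneg (ht : 0 ≤ t) (x : ℝ) : 0 ≤ pairPotential ω t c d u w x := by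
  unfold pairPotential; positivity

theorem integrable_pairPotential (hu : OscDomain u) (hw : OscDomain w) :
    Integrable (pairPotential ω t c d u w) :=
  (((hu.shift_memLp c).integrable_sq.const_mul _).add
    ((hw.shift_memLp d).integrable_sq.const_mul _)).add
      ((hu.memLp.sub hw.memLp).integrable_sq.const_mul _)

/-- At fixed norms, -4t∫uw equals 2t∫(u - w)² up to a constant. The potential part becomes
nonnegative, as Fatou's lemma requires. -/
theorem pairEnergy_eq (hu : OscDomain u) (hw : OscDomain w) :
    pairEnergy ω t c d u w = (∫ x, deriv u x ^ 2) + (∫ x, deriv w x ^ 2) +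
      (∫ x, pairPotential ω t c d u w x) - 2 * t * ((∫ x, u x ^ 2) + ∫ x, w x ^ 2) := by
  have e : ∫ x, (u x - w x) ^ 2 = (∫ x, u x ^ 2) + (∫ x, w x ^ 2) - 2 * ∫ x, u x * w x := by
    rw [← integral_const_mul, ← integral_add hu.memLp.integrable_sq hw.memLp.integrable_sq,
      ← integral_sub]
    · congr 1; ext x; ring
    · exact hu.memLp.integrable_sq.add hw.memLp.integrable_sq
    · exact (hu.memLp.integrable_mul hw.memLp).const_mul 2
  have e2 : ∫ x, pairPotential ω t c d u w x = ω ^ 2 * (∫ x, ((x + c) * u x) ^ 2) +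
      ω ^ 2 * (∫ x, ((x + d) * w x) ^ 2) + 2 * t * ∫ x, (u x - w x) ^ 2 := by
    have i1 := (hu.shift_memLp c).integrable_sq.const_mul (ω ^ 2)
    have i2 := (hw.shift_memLp d).integrable_sq.const_mul (ω ^ 2)
    have i3 : Integrable fun x => 2 * t * (u x - w x) ^ 2 :=
      (hu.memLp.sub hw.memLp).integrable_sq.const_mul (2 * t)
    have i12 : Integrable fun x => ω ^ 2 * ((x + c) * u x) ^ 2 + ω ^ 2 * ((x + d) * w x) ^ 2 :=
      i1.add i2
    unfold pairPotential
    rw [integral_add i12 i3, integral_add i1 i2, integral_const_mul, integral_const_mul,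
      integral_const_mul]
  rw [e2, e, pairEnergy, oscEnergy, oscEnergy]
  ring

theorem OscDomain.abs (hu : OscDomain u) : OscDomain (fun x => |u x|) ∧
    ∫ x, deriv (fun x => |u x|) x ^ 2 ≤ ∫ x, deriv u x ^ 2 := by
  have e : (fun x => |u x|) = fun x => √(u x ^ 2 + (fun _ : ℝ => (0 : ℝ)) x ^ 2) := by
    ext x; simp [Real.sqrt_sq_eq_abs]
  rw [e]
  refine ⟨hu.sqrt_add_sq .zero, (integral_deriv_sqrt_add_sq_le hu .zero).trans ?_⟩
  simp

theorem pairEnergy_abs_le (ht : 0 ≤ t) (hu : OscDomain u) (hw : OscDomain w) :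
    pairEnergy ω t c d (fun x => |u x|) (fun x => |w x|) ≤ pairEnergy ω t c d u w := by
  have h1 := hu.abs.2
  have h2 := hw.abs.2
  have h3 : ∫ x, u x * w x ≤ ∫ x, |u x| * |w x| := by
    refine integral_mono (hu.memLp.integrable_mul hw.memLp)
      (hu.abs.1.memLp.integrable_mul hw.abs.1.memLp) fun x => ?_
    simpa [abs_mul] using le_abs_self (u x * w x)
  have h4 := mul_le_mul_of_nonneg_left h3 (by positivity : 0 ≤ 4 * t)
  simp only [pairEnergy, oscEnergy, mul_pow, sq_abs]
  linarith

theorem exists_integral_sq_eq (ha : 0 ≤ a) : ∃ u, OscDomain u ∧ ∫ x, u x ^ 2 = a := by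
  let β : ContDiffBump (0 : ℝ) := default
  have hβ : OscDomain β := .of_hasCompactSupport β.contDiff β.hasCompactSupport
  have hm : 0 < ∫ x, β x ^ 2 := by
    rw [integral_pos_iff_support_of_nonneg (fun x => sq_nonneg _) hβ.memLp.integrable_sq]
    refine (hβ.continuous.pow 2).isOpen_support.measure_pos volume ⟨0, ?_⟩
    have := β.one_of_mem_closedBall (x := 0) (by simpa using β.rIn_pos.le)
    simp [this]
  refine ⟨_, hβ.const_mul (√(a / ∫ x, β x ^ 2)), ?_⟩
  simp only [mul_pow]
  rw [integral_const_mul, Real.sq_sqrt (by positivity), div_mul_cancel₀ _ hm.ne']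

/-- The pair energy has a nonnegative minimizer among pairs with prescribed norms. -/
theorem exists_pairEnergy_minimizer (hω : 0 < ω) (ht : 0 ≤ t) (c d : ℝ) (ha : 0 ≤ a)
    (hb : 0 ≤ b) : ∃ u w, OscDomain u ∧ OscDomain w ∧ (∀ x, 0 ≤ u x) ∧ (∀ x, 0 ≤ w x) ∧
      ∫ x, u x ^ 2 = a ∧ ∫ x, w x ^ 2 = b ∧
      ∀ u' w', OscDomain u' → OscDomain w' → ∫ x, u' x ^ 2 = a → ∫ x, w' x ^ 2 = b →
        pairEnergy ω t c d u w ≤ pairEnergy ω t c d u' w' := by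
  -- Nonnegativity comes for free: the moduli of a minimizer again form a minimizer.
  suffices h : ∃ u w, OscDomain u ∧ OscDomain w ∧ ∫ x, u x ^ 2 = a ∧ ∫ x, w x ^ 2 = b ∧
      ∀ u' w', OscDomain u' → OscDomain w' → ∫ x, u' x ^ 2 = a → ∫ x, w' x ^ 2 = b →
        pairEnergy ω t c d u w ≤ pairEnergy ω t c d u' w' by
    obtain ⟨u, w, hu, hw, ia, ib, h⟩ := h
    exact ⟨_, _, hu.abs.1, hw.abs.1, fun x => abs_nonneg _, fun x => abs_nonneg _,
      by simpa using ia, by simpa using ib,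
      fun u' w' h1 h2 h3 h4 => (pairEnergy_abs_le ht hu hw).trans (h u' w' h1 h2 h3 h4)⟩
  set V : Set ℝ := {e | ∃ u w, OscDomain u ∧ OscDomain w ∧ ∫ x, u x ^ 2 = a ∧ ∫ x, w x ^ 2 = b ∧
    pairEnergy ω t c d u w = e} with hV
  have hne : V.Nonempty := by
    obtain ⟨u, hu, ia⟩ := exists_integral_sq_eq ha
    obtain ⟨w, hw, ib⟩ := exists_integral_sq_eq hb
    exact ⟨_, u, w, hu, hw, ia, ib, rfl⟩
  have sqnn : ∀ f : ℝ → ℝ, 0 ≤ ∫ x, f x ^ 2 := fun f => integral_nonneg fun x => sq_nonneg _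
  have hbd : BddBelow V := by
    refine ⟨- (2 * t * (a + b)), ?_⟩
    rintro _ ⟨u, w, hu, hw, ia, ib, rfl⟩
    rw [pairEnergy_eq hu hw, ia, ib]
    linarith [sqnn (deriv u), sqnn (deriv w),
      integral_nonneg (μ := volume) (f := pairPotential ω t c d u w) fun x => pairPotential_nonneg ht x]
  obtain ⟨e, -, het, hev⟩ := exists_seq_tendsto_sInf hne hbd
  choose u w hu hw ia ib hE using hev
  obtain ⟨B, hB⟩ := het.bddAbove_range
  have hB' : ∀ n, e n ≤ B := fun n => hB ⟨n, rfl⟩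
  set K := B + 2 * t * (a + b) with hK
  have hsum : ∀ n, (∫ x, deriv (u n) x ^ 2) + (∫ x, deriv (w n) x ^ 2) +
      (∫ x, pairPotential ω t c d (u n) (w n) x) = e n + 2 * t * (a + b) := by
    intro n
    have h := pairEnergy_eq (ω := ω) (t := t) (c := c) (d := d) (hu n) (hw n)
    rw [hE, ia, ib] at h
    linarith
  have hpot : ∀ n, 0 ≤ ∫ x, pairPotential ω t c d (u n) (w n) x :=
    fun n => integral_nonneg fun x => pairPotential_nonneg ht x
  have hK0 : 0 ≤ K := by
    linarith [sqnn (deriv (u 0)), sqnn (deriv (w 0)), hpot 0, hsum 0, hB' 0]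
  have hKC : K ≤ K + K / ω ^ 2 := le_add_of_nonneg_right (by positivity)
  have hpb : ∀ n, ∫ x, pairPotential ω t c d (u n) (w n) x ≤ K := fun n => by
    linarith [sqnn (deriv (u n)), sqnn (deriv (w n)), hsum n, hB' n]
  have hp1 : ∀ n, ∫ x, ((x + c) * u n x) ^ 2 ≤ K + K / ω ^ 2 := by
    intro n
    have h : ω ^ 2 * ∫ x, ((x + c) * u n x) ^ 2 ≤ K := by
      rw [← integral_const_mul]
      refine le_trans (integral_mono (((hu n).shift_memLp c).integrable_sq.const_mul _)
        (integrable_pairPotential (hu n) (hw n)) fun x => ?_) (hpb n)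
      simp only [pairPotential]
      nlinarith [sq_nonneg (ω * ((x + d) * w n x)), mul_nonneg ht (sq_nonneg (u n x - w n x))]
    have h2 : ∫ x, ((x + c) * u n x) ^ 2 ≤ K / ω ^ 2 := by
      rwa [le_div_iff₀ (by positivity), mul_comm]
    linarith
  have hp2 : ∀ n, ∫ x, ((x + d) * w n x) ^ 2 ≤ K + K / ω ^ 2 := by
    intro n
    have h : ω ^ 2 * ∫ x, ((x + d) * w n x) ^ 2 ≤ K := by
      rw [← integral_const_mul]
      refine le_trans (integral_mono (((hw n).shift_memLp d).integrable_sq.const_mul _)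
        (integrable_pairPotential (hu n) (hw n)) fun x => ?_) (hpb n)
      simp only [pairPotential]
      nlinarith [sq_nonneg (ω * ((x + c) * u n x)), mul_nonneg ht (sq_nonneg (u n x - w n x))]
    have h2 : ∫ x, ((x + d) * w n x) ^ 2 ≤ K / ω ^ 2 := by
      rwa [le_div_iff₀ (by positivity), mul_comm]
    linarith
  have hk1 : ∀ n, ∫ x, deriv (u n) x ^ 2 ≤ K + K / ω ^ 2 := fun n => by
    linarith [sqnn (deriv (w n)), hsum n, hB' n, hpot n]
  have hk2 : ∀ n, ∫ x, deriv (w n) x ^ 2 ≤ K + K / ω ^ 2 := fun n => by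
    linarith [sqnn (deriv (u n)), hsum n, hB' n, hpot n]
  obtain ⟨φ₁, hφ₁, u', hu', iu', pu, du⟩ := exists_subseq_of_bounded_energy hu ia hk1 hp1
  obtain ⟨φ₂, hφ₂, w', hw', iw', pw, dw⟩ := exists_subseq_of_bounded_energy
    (fun n => hw (φ₁ n)) (fun n => ib _) (fun n => hk2 _) (fun n => hp2 _)
  refine ⟨u', w', hu', hw', iu', iw', fun u'' w'' h1 h2 h3 h4 => ?_⟩
  refine le_trans ?_ (csInf_le hbd ⟨u'', w'', h1, h2, h3, h4, rfl⟩)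
  -- The lower bound is affine in f', so it passes to the weak limit; with g the limit function it
  -- yields lower semicontinuity of the kinetic energy.
  have hkin : ∀ {f g : ℝ → ℝ}, OscDomain f → OscDomain g →
      2 * (∫ x, deriv f x * deriv g x) - (∫ x, deriv g x ^ 2) ≤ ∫ x, deriv f x ^ 2 := by
    intro f g hf hg
    have hi := (integrable_mul_of_memLp hf.deriv_memLp hg.deriv_memLp).const_mul 2
    rw [← integral_const_mul, ← integral_sub hi hg.deriv_memLp.integrable_sq]
    refine integral_mono (hi.sub hg.deriv_memLp.integrable_sq) hf.deriv_memLp.integrable_sq fun x => ?_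
    simp only
    nlinarith [sq_nonneg (deriv f x - deriv g x)]
  have hlim := ((het.comp (hφ₁.comp hφ₂).tendsto_atTop).add_const (2 * t * (a + b))).sub
    ((((du.comp hφ₂.tendsto_atTop).const_mul 2).sub_const (∫ x, deriv u' x ^ 2)).add
      ((dw.const_mul 2).sub_const (∫ x, deriv w' x ^ 2)))
  -- Along the sequence the potential part is at most the total minus the affine kinetic bounds,
  -- which converges by `hlim`; Fatou bounds the potential part of the limit pair.
  have hfat := integrable_and_integral_le_of_tendsto
    (F := fun n => pairPotential ω t c d (u (φ₁ (φ₂ n))) (w (φ₁ (φ₂ n))))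
    (f := pairPotential ω t c d u' w') (fun n => integrable_pairPotential (hu _) (hw _))
    (fun n x => pairPotential_nonneg ht x) (fun n => by
      simp only [Function.comp]
      linarith [hkin (hu (φ₁ (φ₂ n))) hu', hkin (hw (φ₁ (φ₂ n))) hw', hsum (φ₁ (φ₂ n))]) hlim
    (fun x => by
      have q1 := (pu x).comp hφ₂.tendsto_atTop
      have q2 := pw x
      exact ((((q1.const_mul (x + c)).pow 2).const_mul _).add
        (((q2.const_mul (x + d)).pow 2).const_mul _)).add (((q1.sub q2).pow 2).const_mul _))
  rw [pairEnergy_eq hu' hw', iu', iw']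
  linarith [hfat.2]

end

/-! ### Euler--Lagrange equation and strict positivity. -/

section

/-- A nonnegative `C²` function with `u'' ≤ K u` on a half-line segment which vanishes together with
`u'` at the left end vanishes on it. -/
theorem eq_zero_of_second_deriv_le_right {u v h : ℝ → ℝ} {x₀ R K : ℝ}
    (hu : ∀ x, HasDerivAt u (v x) x) (hv : ∀ x, HasDerivAt v (h x) x) (h0 : ∀ x, 0 ≤ u x)
    (hle : ∀ x ∈ Icc x₀ R, h x ≤ K ^ 2 * u x) (hux : u x₀ = 0) (hvx : v x₀ = 0) :
    ∀ x ∈ Icc x₀ R, u x = 0 := by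
  have he : ∀ r x : ℝ, HasDerivAt (fun x => Real.exp (r * x)) (Real.exp (r * x) * r) x := by
    intro r x
    simpa using ((hasDerivAt_id x).const_mul r).exp
  have d1 : ∀ x, HasDerivAt (fun x => (v x + K * u x) * Real.exp (-K * x))
      ((h x + K * v x) * Real.exp (-K * x) + (v x + K * u x) * (Real.exp (-K * x) * (-K))) x :=
    fun x => ((hv x).add ((hu x).const_mul K)).mul (he (-K) x)
  -- Factor u'' - K²u = (D - K)(D + K)u ≤ 0, with D = d/dx, and integrate the two first-order
  -- inequalities in turn, each with its exponential factor.
  have a1 : AntitoneOn (fun x => (v x + K * u x) * Real.exp (-K * x)) (Icc x₀ R) := by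
    refine antitoneOn_of_deriv_nonpos (convex_Icc _ _)
      (fun x _ => (d1 x).continuousAt.continuousWithinAt)
      (fun x _ => (d1 x).differentiableAt.differentiableWithinAt) fun x hx => ?_
    rw [(d1 x).deriv]
    have := hle x (interior_subset hx)
    have e : (h x + K * v x) * Real.exp (-K * x) + (v x + K * u x) * (Real.exp (-K * x) * (-K)) =
      (h x - K ^ 2 * u x) * Real.exp (-K * x) := by ring
    rw [e]
    exact mul_nonpos_of_nonpos_of_nonneg (by linarith) (Real.exp_pos _).le
  have d2 : ∀ x, HasDerivAt (fun x => u x * Real.exp (K * x))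
      (v x * Real.exp (K * x) + u x * (Real.exp (K * x) * K)) x :=
    fun x => (hu x).mul (he K x)
  have a2 : AntitoneOn (fun x => u x * Real.exp (K * x)) (Icc x₀ R) := by
    refine antitoneOn_of_deriv_nonpos (convex_Icc _ _)
      (fun x _ => (d2 x).continuousAt.continuousWithinAt)
      (fun x _ => (d2 x).differentiableAt.differentiableWithinAt) fun x hx => ?_
    rw [(d2 x).deriv]
    have hx' := interior_subset hx
    have h1 := a1 (left_mem_Icc.2 (hx'.1.trans hx'.2)) hx' hx'.1
    simp only [hux, hvx, mul_zero, add_zero, zero_mul] at h1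
    have h2 : v x + K * u x ≤ 0 := nonpos_of_mul_nonpos_left h1 (Real.exp_pos _)
    have e : v x * Real.exp (K * x) + u x * (Real.exp (K * x) * K) =
      (v x + K * u x) * Real.exp (K * x) := by ring
    rw [e]
    exact mul_nonpos_of_nonpos_of_nonneg h2 (Real.exp_pos _).le
  intro x hx
  have h1 := a2 (left_mem_Icc.2 (hx.1.trans hx.2)) hx hx.1
  simp only [hux, zero_mul] at h1
  exact le_antisymm (nonpos_of_mul_nonpos_left h1 (Real.exp_pos _)) (h0 x)

/-- Strong minimum principle: a nonnegative `C²` function with `u'' ≤ q u`, `q` continuous, is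
either everywhere positive or identically zero. -/
theorem pos_of_second_deriv_le {u v h q : ℝ → ℝ} (hq : Continuous q)
    (hu : ∀ x, HasDerivAt u (v x) x) (hv : ∀ x, HasDerivAt v (h x) x) (h0 : ∀ x, 0 ≤ u x)
    (hle : ∀ x, h x ≤ q x * u x) (hne : ∃ x, u x ≠ 0) (x₀ : ℝ) : 0 < u x₀ := by
  by_contra hx
  have hux : u x₀ = 0 := le_antisymm (not_lt.1 hx) (h0 x₀)
  have hmin : IsLocalMin u x₀ := Eventually.of_forall fun y => by rw [hux]; exact h0 y
  have hvx : v x₀ = 0 := hmin.hasDerivAt_eq_zero (hu x₀)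
  obtain ⟨y, hy⟩ := hne
  obtain ⟨B, hB⟩ := (isCompact_uIcc (a := x₀) (b := y)).bddAbove_image hq.continuousOn
  -- The bound B on q is replaced by a larger perfect square, of the form K² used above.
  have hB' : ∀ x ∈ uIcc x₀ y, h x ≤ (|B| + 1) ^ 2 * u x := fun x hx => (hle x).trans <|
    mul_le_mul_of_nonneg_right (by
      have := hB (mem_image_of_mem q hx)
      nlinarith [le_abs_self B, abs_nonneg B]) (h0 x)
  rcases le_total x₀ y with hxy | hxy
  · rw [uIcc_of_le hxy] at hB'
    exact hy (eq_zero_of_second_deriv_le_right hu hv h0 hB' hux hvx y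
      (right_mem_Icc.2 hxy))
  · rw [uIcc_of_ge hxy] at hB'
    have hu' : ∀ x, HasDerivAt (fun x => u (-x)) (-v (-x)) x := fun x =>
      ((hu (-x)).comp x (hasDerivAt_neg x)).congr_deriv (by simp)
    have hv' : ∀ x, HasDerivAt (fun x => -v (-x)) (h (-x)) x := fun x =>
      ((hv (-x)).comp x (hasDerivAt_neg x)).neg.congr_deriv (by simp)
    have := eq_zero_of_second_deriv_le_right (x₀ := -x₀) (R := -y) hu' hv'
      (fun x => h0 _) (fun x hx => hB' (-x) ⟨by linarith [hx.2], by linarith [hx.1]⟩)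
      (by simpa using hux) (by simpa using hvx) (-y) (right_mem_Icc.2 (by linarith))
    exact hy (by simpa using this)

theorem integral_add_mul_sq {f g : ℝ → ℝ} (hf : MemLp f 2 volume) (hg : MemLp g 2 volume)
    (ε : ℝ) : ∫ x, (f x + ε * g x) ^ 2 =
      (∫ x, f x ^ 2) + 2 * ε * (∫ x, f x * g x) + ε ^ 2 * ∫ x, g x ^ 2 := by
  have i1 := (integrable_mul_of_memLp hf hg).const_mul (2 * ε)
  have i2 := hg.integrable_sq.const_mul (ε ^ 2)
  have i12 : Integrable fun x => f x ^ 2 + 2 * ε * (f x * g x) := hf.integrable_sq.add i1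
  rw [← integral_const_mul, ← integral_const_mul, ← integral_add hf.integrable_sq i1,
    ← integral_add i12 i2]
  congr 1; ext x; ring

variable {ω t c a : ℝ} {u w : ℝ → ℝ}

theorem oscEnergy_add {ζ : ℝ → ℝ} (hu : OscDomain u) (hζ : OscDomain ζ) (ε : ℝ) :
    oscEnergy ω c (fun x => u x + ε * ζ x) = oscEnergy ω c u +
      2 * ε * ((∫ x, deriv u x * deriv ζ x) +
        ω ^ 2 * ∫ x, ((x + c) * u x) * ((x + c) * ζ x)) + ε ^ 2 * oscEnergy ω c ζ := by
  have e1 : ∫ x, deriv (fun x => u x + ε * ζ x) x ^ 2 =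
      ∫ x, (deriv u x + ε * deriv ζ x) ^ 2 := by
    refine integral_congr_ae ?_
    filter_upwards [hu.deriv_add (hζ.const_mul ε)] with x hx
    rw [hx, deriv_const_mul_field]
  have e2 : ∀ x, (x + c) * (u x + ε * ζ x) = (x + c) * u x + ε * ((x + c) * ζ x) :=
    fun x => by ring
  simp only [oscEnergy, e1, e2]
  rw [integral_add_mul_sq hu.deriv_memLp hζ.deriv_memLp,
    integral_add_mul_sq (hu.shift_memLp c) (hζ.shift_memLp c)]
  ring

theorem oscEnergy_const_mul (r : ℝ) :
    oscEnergy ω c (fun x => r * u x) = r ^ 2 * oscEnergy ω c u := by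
  have e : ∀ x, (x + c) * (r * u x) = r * ((x + c) * u x) := fun x => by ring
  simp only [oscEnergy, deriv_const_mul_field, e, mul_pow r, integral_const_mul]
  ring

/-- Euler--Lagrange equation for one component. -/
theorem euler_lagrange {ζ : ℝ → ℝ} (ha : 0 < a) (hu : OscDomain u) (hζ : OscDomain ζ)
    (hw : MemLp w 2 volume) (iu : ∫ x, u x ^ 2 = a)
    (hmin : ∀ u', OscDomain u' → ∫ x, u' x ^ 2 = a →
      oscEnergy ω c u - 4 * t * ∫ x, u x * w x ≤ oscEnergy ω c u' - 4 * t * ∫ x, u' x * w x) :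
    (∫ x, deriv u x * deriv ζ x) + ω ^ 2 * (∫ x, ((x + c) * u x) * ((x + c) * ζ x)) -
      2 * t * (∫ x, ζ x * w x) +
      (2 * t * (∫ x, u x * w x) - oscEnergy ω c u) / a * (∫ x, u x * ζ x) = 0 := by
  set B := (∫ x, deriv u x * deriv ζ x) + ω ^ 2 * ∫ x, ((x + c) * u x) * ((x + c) * ζ x)
  set s := ∫ x, ζ x * w x
  set S := ∫ x, u x * w x with hS
  set A := oscEnergy ω c u with hA
  set n := ∫ x, u x * ζ x
  set Q := oscEnergy ω c ζ
  set m := ∫ x, ζ x ^ 2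
  let N : ℝ → ℝ := fun ε => a + 2 * ε * n + ε ^ 2 * m
  have hN : ∀ ε, ∫ x, (u x + ε * ζ x) ^ 2 = N ε := fun ε => by
    rw [integral_add_mul_sq hu.memLp hζ.memLp, iu]
  -- Energy of the variation √(a / N ε) (u + ε ζ), rescaled so that the norm constraint holds
  -- exactly; differentiating the rescaling produces the multiplier in the statement.
  let f : ℝ → ℝ := fun ε => a / N ε * (A + 2 * ε * B + ε ^ 2 * Q) -
    4 * t * (√(a / N ε) * (S + ε * s))
  have hNd : HasDerivAt N (2 * n) 0 := by
    have h := (((hasDerivAt_id (0 : ℝ)).const_mul 2).mul_const n).const_add a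
    have h2 := h.add (((hasDerivAt_id (0 : ℝ)).pow 2).mul_const m)
    convert! h2 using 1
    simp
  have N0 : N 0 = a := by simp [N]
  have hev : ∀ᶠ ε in 𝓝 (0 : ℝ), 0 < N ε :=
    hNd.continuousAt.eventually (lt_mem_nhds (by rw [N0]; exact ha))
  have f0 : f 0 = A - 4 * t * S := by
    simp [f, N0, ha.ne']
  have hloc : IsLocalMin f 0 := by
    filter_upwards [hev] with ε hε
    have hdom := (hu.add (hζ.const_mul ε)).const_mul (√(a / N ε))
    have h1 := hmin _ hdom (by
      simp only [mul_pow (√(a / N ε))]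
      rw [integral_const_mul, hN, Real.sq_sqrt (by positivity), div_mul_cancel₀ _ hε.ne'])
    rw [oscEnergy_const_mul, oscEnergy_add hu hζ, Real.sq_sqrt (by positivity)] at h1
    have e : ∫ x, √(a / N ε) * (u x + ε * ζ x) * w x = √(a / N ε) * (S + ε * s) := by
      rw [hS, ← integral_const_mul, ← integral_add (integrable_mul_of_memLp hu.memLp hw)
        ((integrable_mul_of_memLp hζ.memLp hw).const_mul ε), ← integral_const_mul]
      congr 1; ext x; ring
    rw [e] at h1
    rw [f0]
    exact h1
  have hinv : HasDerivAt (fun ε => a / N ε) (-(2 * n) / a) 0 := by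
    have h := (hasDerivAt_const (0 : ℝ) a).div hNd (by rw [N0]; exact ha.ne')
    convert! h using 1
    rw [N0]; field_simp; ring
  have q0 : a / N 0 = 1 := by rw [N0, div_self ha.ne']
  have hsq : HasDerivAt (fun ε => √(a / N ε)) (-(2 * n) / a / 2) 0 := by
    have h := hinv.sqrt (by rw [q0]; norm_num)
    convert! h using 1
    rw [q0]; simp
  have hq : HasDerivAt (fun ε : ℝ => A + 2 * ε * B + ε ^ 2 * Q) (2 * B) 0 := by
    have h := (((hasDerivAt_id (0 : ℝ)).const_mul 2).mul_const B).const_add A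
    have h2 := h.add (((hasDerivAt_id (0 : ℝ)).pow 2).mul_const Q)
    convert! h2 using 1
    simp
  have hs : HasDerivAt (fun ε : ℝ => S + ε * s) s 0 := by
    simpa using ((hasDerivAt_id (0 : ℝ)).mul_const s).const_add S
  have hf := (hinv.mul hq).sub ((hsq.mul hs).const_mul (4 * t))
  have hz := hloc.hasDerivAt_eq_zero hf
  rw [q0] at hz
  simp only [Real.sqrt_one, mul_zero, zero_mul, add_zero, ne_eq, OfNat.ofNat_ne_zero,
    not_false_eq_true, zero_pow, one_mul] at hz
  field_simp at hz ⊢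
  linarith

/-- A nonnegative minimizer of the energy of one component at fixed norm is strictly positive. -/
theorem pos_of_minimizer (ht : 0 ≤ t) (ha : 0 < a) (hu : OscDomain u) (hw : OscDomain w)
    (u0 : ∀ x, 0 ≤ u x) (w0 : ∀ x, 0 ≤ w x) (iu : ∫ x, u x ^ 2 = a)
    (hmin : ∀ u', OscDomain u' → ∫ x, u' x ^ 2 = a →
      oscEnergy ω c u - 4 * t * ∫ x, u x * w x ≤ oscEnergy ω c u' - 4 * t * ∫ x, u' x * w x)
    (x : ℝ) : 0 < u x := by
  set μ := (2 * t * (∫ x, u x * w x) - oscEnergy ω c u) / a with hμ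
  set h : ℝ → ℝ := fun x => (ω ^ 2 * (x + c) ^ 2 + μ) * u x - 2 * t * w x with hh
  have hcu := hu.continuous
  have hcw := hw.continuous
  have hc : Continuous h := by fun_prop
  -- The Euler--Lagrange equation says that u' has weak derivative h. As h is continuous, u is C²
  -- and u'' = h holds pointwise.
  obtain ⟨k, hk⟩ := ae_eq_add_integral_of_weak_deriv (f := deriv u) (g := h)
    (hu.deriv_memLp.locallyIntegrable (by norm_num)) hc.locallyIntegrable (fun η s hη => by
      have hζ := OscDomain.of_hasCompactSupport s hη
      have el := euler_lagrange ha hu hζ hw.memLp iu hmin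
      rw [← hμ] at el
      have i1 := (integrable_mul_of_memLp (hu.shift_memLp c) (hζ.shift_memLp c)).const_mul (ω ^ 2)
      have i2 := (integrable_mul_of_memLp hζ.memLp hw.memLp).const_mul (2 * t)
      have i3 := (integrable_mul_of_memLp hu.memLp hζ.memLp).const_mul μ
      have i12 : Integrable fun x => ω ^ 2 * ((x + c) * u x * ((x + c) * η x)) -
        2 * t * (η x * w x) := i1.sub i2
      have e : ∫ x, η x * h x = ω ^ 2 * (∫ x, (x + c) * u x * ((x + c) * η x)) -
          2 * t * (∫ x, η x * w x) + μ * ∫ x, u x * η x := by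
        rw [← integral_const_mul, ← integral_const_mul, ← integral_const_mul,
          ← integral_sub i1 i2, ← integral_add i12 i3]
        congr 1; ext x; simp only [hh]; ring
      have e2 : ∫ x, deriv η x * deriv u x = ∫ x, deriv u x * deriv η x := by
        congr 1; ext x; ring
      rw [e, e2]
      linarith)
  set v : ℝ → ℝ := fun x => k + ∫ s in (0 : ℝ)..x, h s with hv
  have hv' : ∀ x, HasDerivAt v (h x) x := fun x =>
    (hc.integral_hasStrictDerivAt 0 x).hasDerivAt.const_add k
  have hvc : Continuous v := continuous_iff_continuousAt.2 fun x => (hv' x).continuousAt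
  have hu' : ∀ x, HasDerivAt u (v x) x := by
    have e : u = fun x => u 0 + ∫ s in (0 : ℝ)..x, v s := by
      ext x
      rw [hu.ac.eq_add_integral 0 x]
      congr 1
      refine intervalIntegral.integral_congr_ae ?_
      filter_upwards [hk] with s hs _ using hs
    intro x
    rw [e]
    exact (hvc.integral_hasStrictDerivAt 0 x).hasDerivAt.const_add _
  refine pos_of_second_deriv_le (q := fun x => ω ^ 2 * (x + c) ^ 2 + μ) (by fun_prop) hu' hv' u0
    (fun x => ?_) ?_ x
  · simp only [hh]
    have := mul_nonneg ht (w0 x)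
    linarith
  · by_contra hz
    push Not at hz
    simp [hz] at iu
    exact ha.ne iu

end

/-! ### Uniqueness by convexity in the densities. -/

section

/-- The quotient φ / u is locally absolutely continuous, since u is bounded below on compact
intervals, and its derivative vanishes almost everywhere; so it is constant. -/
theorem eq_const_mul_of_ae_wronskian_eq_zero {u φ : ℝ → ℝ} (hu : LocallyAC u) (hφ : LocallyAC φ)
    (u0 : ∀ x, 0 < u x) (h : ∀ᵐ x, u x * deriv φ x = φ x * deriv u x) :
    ∃ κ, ∀ x, φ x = κ * u x := by
  have hq : LocallyAC fun x => φ x / u x := by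
    refine hu.of_dist_le hφ fun a b => ?_
    obtain ⟨z, -, hz⟩ := (isCompact_uIcc (a := a) (b := b)).exists_isMinOn nonempty_uIcc
      hu.continuous.continuousOn
    obtain ⟨M, hM⟩ := (isCompact_uIcc (a := a) (b := b)).exists_bound_of_continuousOn
      (f := fun x => |u x| + |φ x|) (by
        have := hu.continuous; have := hφ.continuous; fun_prop)
    have hδ := u0 z
    refine ⟨M / u z ^ 2, fun x hx y hy => ?_⟩
    have hMx : |u y| ≤ M := by
      have := hM y hy
      rw [Real.norm_eq_abs, abs_of_nonneg (by positivity)] at this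
      linarith [abs_nonneg (φ y)]
    have hMy : |φ y| ≤ M := by
      have := hM y hy
      rw [Real.norm_eq_abs, abs_of_nonneg (by positivity)] at this
      linarith [abs_nonneg (u y)]
    have hM0 : 0 ≤ M := (abs_nonneg _).trans hMx
    have hden : u z ^ 2 ≤ u x * u y := by
      rw [sq]; exact mul_le_mul (hz hx) (hz hy) hδ.le (u0 x).le
    rw [Real.dist_eq, Real.dist_eq, Real.dist_eq, div_sub_div _ _ (u0 x).ne' (u0 y).ne', abs_div,
      abs_of_pos (mul_pos (u0 x) (u0 y)), div_mul_eq_mul_div]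
    refine div_le_div₀ (by positivity) ?_ (by positivity) hden
    calc |φ x * u y - u x * φ y| = |(φ x - φ y) * u y - (u x - u y) * φ y| := by congr 1; ring
      _ ≤ |φ x - φ y| * |u y| + |u x - u y| * |φ y| := by
          rw [← abs_mul, ← abs_mul]; exact abs_sub _ _
      _ ≤ |φ x - φ y| * M + |u x - u y| * M := by gcongr
      _ = _ := by ring
  refine ⟨φ 0 / u 0, fun x => ?_⟩
  have h1 := hq.eq_add_integral 0 x
  have h2 : ∫ s in (0 : ℝ)..x, deriv (fun x => φ x / u x) s = 0 := by
    refine intervalIntegral.integral_zero_ae ?_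
    filter_upwards [h, hu.ae_differentiableAt, hφ.ae_differentiableAt] with s hs d1 d2 _
    rw [(d2.hasDerivAt.fun_div d1.hasDerivAt (u0 s).ne').deriv]
    rw [show deriv φ s * u s - φ s * deriv u s = 0 by linarith, zero_div]
  rw [h2, add_zero] at h1
  rw [← h1, div_mul_cancel₀ _ (u0 x).ne']

/-- Equality in the convexity of the kinetic energy as a function of the density. -/
theorem eq_const_mul_of_le_integral_deriv_sqrt {u φ : ℝ → ℝ} (hu : OscDomain u)
    (hφ : OscDomain φ) (u0 : ∀ x, 0 < u x)
    (h : (∫ x, deriv u x ^ 2) + (∫ x, deriv φ x ^ 2) ≤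
      ∫ x, deriv (fun x => √(u x ^ 2 + φ x ^ 2)) x ^ 2) :
    ∃ κ, ∀ x, φ x = κ * u x := by
  refine eq_const_mul_of_ae_wronskian_eq_zero hu.ac hφ.ac u0 ?_
  have i1 := hu.deriv_memLp.integrable_sq
  have i2 := hφ.deriv_memLp.integrable_sq
  have i12 : Integrable fun x => deriv u x ^ 2 + deriv φ x ^ 2 := i1.add i2
  have i3 := (hu.sqrt_add_sq hφ).deriv_memLp.integrable_sq
  have hnn : 0 ≤ᵐ[volume] fun x => deriv u x ^ 2 + deriv φ x ^ 2 -
      deriv (fun x => √(u x ^ 2 + φ x ^ 2)) x ^ 2 := by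
    filter_upwards [hu.ac.deriv_sqrt_add_sq_le hφ.ac] with x hx
    simpa using hx
  have hz := (integral_eq_zero_iff_of_nonneg_ae hnn (i12.sub i3)).1 (le_antisymm (by
    rw [integral_sub i12 i3, integral_add i1 i2]; linarith) (integral_nonneg_of_ae hnn))
  filter_upwards [hz, hu.ac.ae_differentiableAt, hφ.ac.ae_differentiableAt] with x hx d1 d2
  have hp : 0 < u x ^ 2 + φ x ^ 2 := by have := u0 x; positivity
  have hd := ((d1.hasDerivAt.pow 2).add (d2.hasDerivAt.pow 2)).sqrt hp.ne'
  have hd' := hd.deriv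
  have hd2 : deriv (fun x => √(u x ^ 2 + φ x ^ 2)) x =
      (u x * deriv u x + φ x * deriv φ x) / √(u x ^ 2 + φ x ^ 2) := by
    refine Eq.trans hd' ?_
    have := (Real.sqrt_pos.2 hp).ne'
    simp
    field_simp
  simp only [Pi.zero_apply] at hx
  rw [hd2, div_pow, Real.sq_sqrt hp.le, sub_eq_zero, eq_div_iff hp.ne'] at hx
  -- Lagrange's identity: the kinetic defect times u² + φ² is the squared Wronskian.
  have : (u x * deriv φ x - φ x * deriv u x) ^ 2 = 0 := by linarith
  exact sub_eq_zero.1 (pow_eq_zero_iff two_ne_zero |>.1 this)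

variable {ω t c d a b : ℝ} {u φ w θ : ℝ → ℝ}

/-- The square root of the mean of two densities. -/
def densityMean (u φ : ℝ → ℝ) (x : ℝ) : ℝ := √((√(1 / 2) * u x) ^ 2 + (√(1 / 2) * φ x) ^ 2)

theorem densityMean_sq (x : ℝ) : densityMean u φ x ^ 2 = (u x ^ 2 + φ x ^ 2) / 2 := by
  rw [densityMean, Real.sq_sqrt (by positivity), mul_pow, mul_pow, Real.sq_sqrt (by norm_num)]
  ring

theorem OscDomain.densityMean (hu : OscDomain u) (hφ : OscDomain φ) :
    OscDomain (densityMean u φ) :=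
  (hu.const_mul _).sqrt_add_sq (hφ.const_mul _)

theorem integral_deriv_const_mul_sq : ∫ x, deriv (fun x => √(1 / 2) * u x) x ^ 2 =
    (∫ x, deriv u x ^ 2) / 2 := by
  simp only [deriv_const_mul_field, mul_pow √(1 / 2), integral_const_mul]
  rw [Real.sq_sqrt (by norm_num)]
  ring

theorem integral_deriv_densityMean_le (hu : OscDomain u) (hφ : OscDomain φ) :
    ∫ x, deriv (densityMean u φ) x ^ 2 ≤
      ((∫ x, deriv u x ^ 2) + ∫ x, deriv φ x ^ 2) / 2 := by
  refine (integral_deriv_sqrt_add_sq_le (hu.const_mul √(1 / 2)) (hφ.const_mul √(1 / 2))).trans ?_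
  rw [integral_deriv_const_mul_sq, integral_deriv_const_mul_sq, add_div]

theorem integral_mul_densityMean_sq {f : ℝ → ℝ} (hu : MemLp (fun x => f x * u x) 2 volume)
    (hφ : MemLp (fun x => f x * φ x) 2 volume) : ∫ x, (f x * densityMean u φ x) ^ 2 =
      ((∫ x, (f x * u x) ^ 2) + ∫ x, (f x * φ x) ^ 2) / 2 := by
  rw [← integral_add hu.integrable_sq hφ.integrable_sq, ← integral_div]
  congr 1; ext x
  rw [mul_pow, densityMean_sq]; ring

theorem integral_densityMean_sq (hu : OscDomain u) (hφ : OscDomain φ)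
    (iu : ∫ x, u x ^ 2 = a) (iφ : ∫ x, φ x ^ 2 = a) : ∫ x, densityMean u φ x ^ 2 = a := by
  have h := integral_mul_densityMean_sq (f := fun _ => 1) (by simpa using hu.memLp)
    (by simpa using hφ.memLp)
  simp only [one_mul, iu, iφ] at h
  linarith

/-- Cauchy--Schwarz in the plane. It makes the tunnelling term -4t∫uw convex in the densities. -/
theorem mul_add_mul_le_densityMean (x : ℝ) :
    (u x * w x + φ x * θ x) / 2 ≤ densityMean u φ x * densityMean w θ x := by
  rw [densityMean, densityMean, ← Real.sqrt_mul (by positivity)]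
  refine Real.le_sqrt_of_sq_le ?_
  simp only [mul_pow, Real.sq_sqrt (by norm_num : (0 : ℝ) ≤ 1 / 2)]
  nlinarith [sq_nonneg (u x * θ x - φ x * w x)]

/-- The potential energy is linear in the density, so the only gain over the average is the kinetic
defect. For two minimizers this defect must vanish. -/
theorem oscEnergy_densityMean (hu : OscDomain u) (hφ : OscDomain φ) :
    oscEnergy ω c (densityMean u φ) = (oscEnergy ω c u + oscEnergy ω c φ) / 2 -
      (((∫ x, deriv u x ^ 2) + ∫ x, deriv φ x ^ 2) / 2 -
        ∫ x, deriv (densityMean u φ) x ^ 2) := by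
  have h := integral_mul_densityMean_sq (hu.shift_memLp c) (hφ.shift_memLp c)
  simp only [oscEnergy, h]
  ring

theorem eq_of_le_integral_deriv_densityMean (ha : a ≠ 0) (hu : OscDomain u) (hφ : OscDomain φ)
    (u0 : ∀ x, 0 < u x) (φ0 : ∀ x, 0 < φ x) (iu : ∫ x, u x ^ 2 = a) (iφ : ∫ x, φ x ^ 2 = a)
    (h : ((∫ x, deriv u x ^ 2) + ∫ x, deriv φ x ^ 2) / 2 ≤
        ∫ x, deriv (densityMean u φ) x ^ 2) : u = φ := by
  have hr : 0 < √(1 / 2 : ℝ) := Real.sqrt_pos.2 (by norm_num)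
  obtain ⟨κ, hκ⟩ := eq_const_mul_of_le_integral_deriv_sqrt (hu.const_mul √(1 / 2))
    (hφ.const_mul √(1 / 2)) (fun x => mul_pos hr (u0 x)) (by
      rw [integral_deriv_const_mul_sq, integral_deriv_const_mul_sq, ← add_div]
      exact h)
  have hκ' : ∀ x, φ x = κ * u x := fun x =>
    mul_left_cancel₀ hr.ne' ((hκ x).trans (by ring))
  have h2 : κ ^ 2 * a = a := by
    rw [← iu, ← integral_const_mul, iu, ← iφ]
    congr 1; ext x; rw [hκ' x]; ring
  have h3 : κ ^ 2 = 1 := mul_right_cancel₀ ha (by rw [h2, one_mul])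
  have hκ0 : 0 < κ := pos_of_mul_pos_left (by rw [← hκ' 0]; exact φ0 0) (u0 0).le
  have : κ = 1 := by nlinarith
  ext x
  rw [hκ' x, this, one_mul]

theorem eq_zero_of_integral_sq_eq_zero (hu : OscDomain u) (iu : ∫ x, u x ^ 2 = 0) :
    u = fun _ => 0 := by
  have h := (integral_eq_zero_iff_of_nonneg (fun x => sq_nonneg (u x)) hu.memLp.integrable_sq).1 iu
  refine hu.continuous.ae_eq_iff_eq volume continuous_const |>.1 ?_
  filter_upwards [h] with x hx
  simpa using hx

/-- Two minimizers of the pair energy with positive components coincide. -/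
theorem pairEnergy_minimizer_unique (ht : 0 ≤ t) (hu : OscDomain u) (hφ : OscDomain φ)
    (hw : OscDomain w) (hθ : OscDomain θ) (u0 : a ≠ 0 → ∀ x, 0 < u x) (φ0 : a ≠ 0 → ∀ x, 0 < φ x)
    (w0 : b ≠ 0 → ∀ x, 0 < w x) (θ0 : b ≠ 0 → ∀ x, 0 < θ x)
    (iu : ∫ x, u x ^ 2 = a) (iφ : ∫ x, φ x ^ 2 = a) (iw : ∫ x, w x ^ 2 = b)
    (iθ : ∫ x, θ x ^ 2 = b)
    (h1 : ∀ u' w', OscDomain u' → OscDomain w' → ∫ x, u' x ^ 2 = a → ∫ x, w' x ^ 2 = b →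
      pairEnergy ω t c d u w ≤ pairEnergy ω t c d u' w')
    (h2 : ∀ u' w', OscDomain u' → OscDomain w' → ∫ x, u' x ^ 2 = a → ∫ x, w' x ^ 2 = b →
      pairEnergy ω t c d φ θ ≤ pairEnergy ω t c d u' w') : u = φ ∧ w = θ := by
  have m1 := h1 _ _ (hu.densityMean hφ) (hw.densityMean hθ) (integral_densityMean_sq hu hφ iu iφ)
    (integral_densityMean_sq hw hθ iw iθ)
  have m2 := h2 _ _ (hu.densityMean hφ) (hw.densityMean hθ) (integral_densityMean_sq hu hφ iu iφ)
    (integral_densityMean_sq hw hθ iw iθ)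
  have hx : ((∫ x, u x * w x) + ∫ x, φ x * θ x) / 2 ≤
      ∫ x, densityMean u φ x * densityMean w θ x := by
    have i1 := integrable_mul_of_memLp hu.memLp hw.memLp
    have i2 := integrable_mul_of_memLp hφ.memLp hθ.memLp
    rw [← integral_add i1 i2, ← integral_div]
    exact integral_mono ((i1.add i2).div_const 2) (integrable_mul_of_memLp
      (hu.densityMean hφ).memLp (hw.densityMean hθ).memLp) fun x => mul_add_mul_le_densityMean x
  have hx' := mul_le_mul_of_nonneg_left hx (by positivity : 0 ≤ 4 * t)
  have k1 := integral_deriv_densityMean_le hu hφ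
  have k2 := integral_deriv_densityMean_le hw hθ
  simp only [pairEnergy] at m1 m2
  rw [oscEnergy_densityMean hu hφ, oscEnergy_densityMean hw hθ] at m1 m2
  constructor
  · by_cases ha : a = 0
    · rw [ha] at iu iφ
      rw [eq_zero_of_integral_sq_eq_zero hu iu, eq_zero_of_integral_sq_eq_zero hφ iφ]
    · exact eq_of_le_integral_deriv_densityMean ha hu hφ (u0 ha) (φ0 ha) iu iφ (by linarith)
  · by_cases hb : b = 0
    · rw [hb] at iw iθ
      rw [eq_zero_of_integral_sq_eq_zero hw iw, eq_zero_of_integral_sq_eq_zero hθ iθ]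
    · exact eq_of_le_integral_deriv_densityMean hb hw hθ (w0 hb) (θ0 hb) iw iθ (by linarith)

end

/-! ### From real pairs to states; removal of the displacement constraint. -/

section

variable {u w : ℝ → ℝ}

/-- A real square integrable function as an element of `L²(ℝ, ℂ)`. -/
def realToL2 (hu : MemLp u 2 volume) : L2 :=
  MemLp.toLp (fun x => (u x : ℂ)) (hu.ofReal (K := ℂ))

theorem coeFn_realToL2 (hu : MemLp u 2 volume) : ∀ᵐ x, realToL2 hu x = (u x : ℂ) :=
  MemLp.coeFn_toLp _

/-- The element of `L²(ℝ, ℂ)` given by a real function of the form domain. -/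
def OscDomain.toL2 (hu : OscDomain u) : L2 := realToL2 hu.memLp

theorem OscDomain.coeFn_toL2 (hu : OscDomain u) : ∀ᵐ x, hu.toL2 x = (u x : ℂ) :=
  coeFn_realToL2 _

theorem integral_smul_realToL2 (hu : MemLp u 2 volume) (η : ℝ → ℝ) :
    ∫ x, η x • realToL2 hu x = ((∫ x, η x * u x : ℝ) : ℂ) := by
  rw [← integral_complex_ofReal]
  refine integral_congr_ae ?_
  filter_upwards [coeFn_realToL2 hu] with x hx
  rw [hx, Complex.real_smul, Complex.ofReal_mul]

theorem OscDomain.isWeakDeriv_toL2 (hu : OscDomain u) :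
    IsWeakDeriv hu.toL2 (realToL2 hu.deriv_memLp) := by
  intro η s c
  rw [OscDomain.toL2, integral_smul_realToL2, integral_smul_realToL2, hu.ac.integral_deriv_mul s c,
    Complex.ofReal_neg]

theorem OscDomain.norm_weakDeriv_toL2_sq (hu : OscDomain u) :
    ‖weakDeriv hu.toL2‖ ^ 2 = ∫ x, deriv u x ^ 2 := by
  rw [hu.isWeakDeriv_toL2.weakDeriv_eq, L2.norm_sq_eq_integral]
  refine integral_congr_ae ?_
  filter_upwards [coeFn_realToL2 hu.deriv_memLp] with x hx
  rw [hx]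
  simp

theorem OscDomain.finiteOscillatorEnergy_toL2 (hu : OscDomain u) :
    FiniteOscillatorEnergy hu.toL2 := by
  refine ⟨⟨_, hu.isWeakDeriv_toL2⟩, (memLp_congr_ae ?_).1 (hu.mul_memLp.ofReal (K := ℂ))⟩
  filter_upwards [hu.coeFn_toL2] with x hx
  rw [hx]
  simp

/-- The state with real components `u` and `w`. -/
def pairState (hu : OscDomain u) (hw : OscDomain w) : State :=
  WithLp.toLp 2 (hu.toL2, hw.toL2)

theorem pairState_mem_admissible (hu : OscDomain u) (hw : OscDomain w) :
    pairState hu hw ∈ admissible :=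
  ⟨hu.finiteOscillatorEnergy_toL2, hw.finiteOscillatorEnergy_toL2⟩

/-- The densities of the components of `ψ` are `u²` and `w²`. -/
structure HasDensities (ψ : State) (u w : ℝ → ℝ) : Prop where
  fst : ∀ᵐ x, ‖ψ.fst x‖ ^ 2 = u x ^ 2
  snd : ∀ᵐ x, ‖ψ.snd x‖ ^ 2 = w x ^ 2

theorem hasDensities_pairState (hu : OscDomain u) (hw : OscDomain w) :
    HasDensities (pairState hu hw) u w where
  fst := by
    filter_upwards [hu.coeFn_toL2] with x hx
    rw [show (pairState hu hw).fst = hu.toL2 from rfl, hx]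
    simp
  snd := by
    filter_upwards [hw.coeFn_toL2] with x hx
    rw [show (pairState hu hw).snd = hw.toL2 from rfl, hx]
    simp

/-- The internal energy of a state with real components. -/
def realEnergy (ω t g lam : ℝ) (u w : ℝ → ℝ) : ℝ :=
  1 / 2 * ((∫ x, deriv u x ^ 2) + ∫ x, deriv w x ^ 2) +
    ω ^ 2 / 2 * ((∫ x, (x * u x) ^ 2) + ∫ x, (x * w x) ^ 2) - 2 * t * (∫ x, u x * w x) +
    lam * g * ((∫ x, x * u x ^ 2) - ∫ x, x * w x ^ 2)

theorem OscDomain.integrable_mul_sq (hu : OscDomain u) : Integrable fun x => x * u x ^ 2 := by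
  have h := integrable_mul_of_memLp hu.mul_memLp hu.memLp
  simpa only [sq, mul_assoc] using h

namespace HasDensities

variable {ψ : State}

theorem norm_fst_sq (h : HasDensities ψ u w) : ‖ψ.fst‖ ^ 2 = ∫ x, u x ^ 2 := by
  rw [L2.norm_sq_eq_integral]
  exact integral_congr_ae h.fst

theorem norm_snd_sq (h : HasDensities ψ u w) : ‖ψ.snd‖ ^ 2 = ∫ x, w x ^ 2 := by
  rw [L2.norm_sq_eq_integral]
  exact integral_congr_ae h.snd

theorem evXSq_eq (h : HasDensities ψ u w) (hu : OscDomain u) (hw : OscDomain w) :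
    evXSq ψ = (∫ x, (x * u x) ^ 2) + ∫ x, (x * w x) ^ 2 := by
  rw [evXSq, ← integral_add hu.mul_memLp.integrable_sq hw.mul_memLp.integrable_sq]
  refine integral_congr_ae ?_
  filter_upwards [h.fst, h.snd] with x h1 h2
  rw [h1, h2]; ring

theorem evX_eq (h : HasDensities ψ u w) (hu : OscDomain u) (hw : OscDomain w) :
    evX ψ = (∫ x, x * u x ^ 2) + ∫ x, x * w x ^ 2 := by
  rw [evX, ← integral_add hu.integrable_mul_sq hw.integrable_mul_sq]
  refine integral_congr_ae ?_
  filter_upwards [h.fst, h.snd] with x h1 h2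
  rw [h1, h2]; ring

theorem evSigmaZX_eq (h : HasDensities ψ u w) (hu : OscDomain u) (hw : OscDomain w) :
    evSigmaZX ψ = (∫ x, x * u x ^ 2) - ∫ x, x * w x ^ 2 := by
  rw [evSigmaZX, ← integral_sub hu.integrable_mul_sq hw.integrable_mul_sq]
  refine integral_congr_ae ?_
  filter_upwards [h.fst, h.snd] with x h1 h2
  rw [h1, h2]; ring

theorem mem_constraintManifold_iff (h : HasDensities ψ u w) (hu : OscDomain u)
    (hw : OscDomain w) (hψ : ψ ∈ admissible) {σ ξ : ℝ} :
    ψ ∈ constraintManifold σ ξ ↔ ∫ x, u x ^ 2 = (1 + σ) / 2 ∧ ∫ x, w x ^ 2 = (1 - σ) / 2 ∧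
      (∫ x, x * u x ^ 2) + ∫ x, x * w x ^ 2 = ξ := by
  have hn : ‖ψ‖ ^ 2 = ‖ψ.fst‖ ^ 2 + ‖ψ.snd‖ ^ 2 := WithLp.prod_norm_sq_eq_of_L2 ψ
  have h1 : ‖ψ‖ = 1 ↔ ‖ψ‖ ^ 2 = 1 := (pow_eq_one_iff_of_nonneg (norm_nonneg ψ) two_ne_zero).symm
  simp only [constraintManifold, Set.mem_ofPred_eq, hψ, true_and, h1, hn, evSigmaZ, h.norm_fst_sq,
    h.norm_snd_sq, h.evX_eq hu hw]
  constructor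
  · rintro ⟨h1, h2, h3⟩
    exact ⟨by linarith, by linarith, h3⟩
  · rintro ⟨h1, h2, h3⟩
    exact ⟨by linarith, by linarith, h3⟩

end HasDensities

variable {ω t g lam : ℝ}

theorem internalEnergy_pairState (hu : OscDomain u) (hw : OscDomain w) :
    internalEnergy ω t g lam (pairState hu hw) = realEnergy ω t g lam u w := by
  have h := hasDensities_pairState hu hw
  have e : evSigmaX (pairState hu hw) = 2 * ∫ x, u x * w x := by
    rw [evSigmaX, MeasureTheory.L2.inner_def, ← RCLike.re_eq_complex_re,
      ← integral_re (MeasureTheory.L2.integrable_inner _ _)]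
    congr 1
    refine integral_congr_ae ?_
    filter_upwards [hu.coeFn_toL2, hw.coeFn_toL2] with x h1 h2
    rw [show (pairState hu hw).fst = hu.toL2 from rfl,
      show (pairState hu hw).snd = hw.toL2 from rfl, h1, h2]
    simp [mul_comm]
  have e2 : evPSq (pairState hu hw) = (∫ x, deriv u x ^ 2) + ∫ x, deriv w x ^ 2 := by
    rw [← hu.norm_weakDeriv_toL2_sq, ← hw.norm_weakDeriv_toL2_sq]
    rfl
  rw [internalEnergy, e, e2, h.evXSq_eq hu hw, h.evSigmaZX_eq hu hw, realEnergy]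
  ring

/-- Passing to moduli does not increase the energy. -/
theorem exists_realEnergy_le (ht : 0 ≤ t) {ψ : State} (hψ : ψ ∈ admissible) :
    ∃ u w, OscDomain u ∧ OscDomain w ∧ (∀ᵐ x, ‖ψ.fst x‖ = u x) ∧ (∀ᵐ x, ‖ψ.snd x‖ = w x) ∧
      HasDensities ψ u w ∧ realEnergy ω t g lam u w ≤ internalEnergy ω t g lam ψ := by
  obtain ⟨u, hu, -, eu, ku⟩ := hψ.1.exists_norm_eq
  obtain ⟨w, hw, -, ew, kw⟩ := hψ.2.exists_norm_eq
  have h : HasDensities ψ u w :=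
    ⟨eu.mono fun x hx => by rw [hx], ew.mono fun x hx => by rw [hx]⟩
  refine ⟨u, w, hu, hw, eu, ew, h, ?_⟩
  have hs : evSigmaX ψ ≤ 2 * ∫ x, u x * w x := by
    rw [evSigmaX, MeasureTheory.L2.inner_def, ← RCLike.re_eq_complex_re,
      ← integral_re (MeasureTheory.L2.integrable_inner _ _)]
    refine mul_le_mul_of_nonneg_left (integral_mono_ae
      (MeasureTheory.L2.integrable_inner _ _).re (integrable_mul_of_memLp hu.memLp hw.memLp) ?_)
      zero_le_two
    filter_upwards [eu, ew] with x h1 h2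
    rw [← h1, ← h2]
    exact (RCLike.re_le_norm _).trans (norm_inner_le_norm _ _)
  have hs' := mul_le_mul_of_nonneg_left hs ht
  rw [internalEnergy, h.evXSq_eq hu hw, h.evSigmaZX_eq hu hw, realEnergy, evPSq]
  linarith

theorem integral_shift_mul_sq (hu : OscDomain u) (c : ℝ) :
    ∫ x, ((x + c) * u x) ^ 2 =
      (∫ x, (x * u x) ^ 2) + 2 * c * (∫ x, x * u x ^ 2) + c ^ 2 * ∫ x, u x ^ 2 := by
  have h := integral_add_mul_sq hu.mul_memLp hu.memLp c
  have e1 : ∀ x, x * u x + c * u x = (x + c) * u x := fun x => by ring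
  have e2 : ∀ x, x * u x * u x = x * u x ^ 2 := fun x => by ring
  simpa only [e1, e2] using h

theorem integral_sq_comp_add (s : ℝ) : ∫ x, u (x + s) ^ 2 = ∫ x, u x ^ 2 :=
  integral_add_right_eq_self (fun x => u x ^ 2) s

theorem integral_mul_sq_comp_add (hu : OscDomain u) (s : ℝ) :
    ∫ x, x * u (x + s) ^ 2 = (∫ x, x * u x ^ 2) - s * ∫ x, u x ^ 2 := by
  have h := integral_add_right_eq_self (μ := volume) (fun x => (x - s) * u x ^ 2) s
  simp only [add_sub_cancel_right] at h
  rw [h, ← integral_const_mul, ← integral_sub hu.integrable_mul_sq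
    (hu.memLp.integrable_sq.const_mul s)]
  congr 1; ext x; ring

theorem integral_sq_mul_comp_add (hu : OscDomain u) (s : ℝ) :
    ∫ x, (x * u (x + s)) ^ 2 =
      (∫ x, (x * u x) ^ 2) - 2 * s * (∫ x, x * u x ^ 2) + s ^ 2 * ∫ x, u x ^ 2 := by
  have h := integral_add_right_eq_self (μ := volume) (fun x => ((x + -s) * u x) ^ 2) s
  simp only [add_neg_cancel_right] at h
  rw [h, integral_shift_mul_sq hu]
  ring

theorem realEnergy_comp_add (hu : OscDomain u) (hw : OscDomain w) (s : ℝ) :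
    realEnergy ω t g lam (fun x => u (x + s)) (fun x => w (x + s)) = realEnergy ω t g lam u w +
      ω ^ 2 / 2 * (s ^ 2 * ((∫ x, u x ^ 2) + ∫ x, w x ^ 2) -
        2 * s * ((∫ x, x * u x ^ 2) + ∫ x, x * w x ^ 2)) -
      lam * g * s * ((∫ x, u x ^ 2) - ∫ x, w x ^ 2) := by
  have e1 : ∀ f : ℝ → ℝ, ∫ x, deriv (fun x => f (x + s)) x ^ 2 = ∫ x, deriv f x ^ 2 := fun f => by
    simp only [deriv_comp_add_const]
    exact integral_sq_comp_add s
  have e2 : ∫ x, u (x + s) * w (x + s) = ∫ x, u x * w x :=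
    integral_add_right_eq_self (fun x => u x * w x) s
  simp only [realEnergy, e1, e2, integral_mul_sq_comp_add hu, integral_mul_sq_comp_add hw,
    integral_sq_mul_comp_add hu, integral_sq_mul_comp_add hw]
  ring

variable {σ ξ c d : ℝ}

/-- The centres absorb the coupling ±λg x, leaving the same multiplier ω²ξ + λgσ in front of both
first moments. Only their sum, the displacement, then appears outside the pair energy. -/
theorem realEnergy_eq (hu : OscDomain u) (hw : OscDomain w) (iu : ∫ x, u x ^ 2 = (1 + σ) / 2)
    (iw : ∫ x, w x ^ 2 = (1 - σ) / 2) (hc : ω ^ 2 * (c + ξ) = lam * g * (1 - σ))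
    (hd : ω ^ 2 * (d + ξ) = - (lam * g * (1 + σ))) :
    realEnergy ω t g lam u w = pairEnergy ω t c d u w / 2 +
      (ω ^ 2 * ξ + lam * g * σ) * ((∫ x, x * u x ^ 2) + ∫ x, x * w x ^ 2) -
      ω ^ 2 / 4 * (c ^ 2 * (1 + σ) + d ^ 2 * (1 - σ)) := by
  rw [realEnergy, pairEnergy, oscEnergy, oscEnergy, integral_shift_mul_sq hu,
    integral_shift_mul_sq hw, iu, iw]
  linear_combination (∫ x, x * u x ^ 2) * (-hc) - (∫ x, x * w x ^ 2) * hd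

/-- A pair with the right norms can be translated to the right displacement, and the pair energy
controls the energy of the translate. -/
theorem exists_comp_add_realEnergy_le (hu : OscDomain u) (hw : OscDomain w)
    (iu : ∫ x, u x ^ 2 = (1 + σ) / 2) (iw : ∫ x, w x ^ 2 = (1 - σ) / 2)
    (hc : ω ^ 2 * (c + ξ) = lam * g * (1 - σ)) (hd : ω ^ 2 * (d + ξ) = - (lam * g * (1 + σ))) :
    ∃ s, pairState (hu.comp_add s) (hw.comp_add s) ∈ constraintManifold σ ξ ∧
      internalEnergy ω t g lam (pairState (hu.comp_add s) (hw.comp_add s)) ≤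
        pairEnergy ω t c d u w / 2 + (ω ^ 2 * ξ + lam * g * σ) * ξ -
          ω ^ 2 / 4 * (c ^ 2 * (1 + σ) + d ^ 2 * (1 - σ)) := by
  set X := (∫ x, x * u x ^ 2) + ∫ x, x * w x ^ 2 with hX
  refine ⟨X - ξ, ?_, ?_⟩
  · rw [(hasDensities_pairState _ _).mem_constraintManifold_iff (hu.comp_add _) (hw.comp_add _)
      (pairState_mem_admissible _ _), integral_sq_comp_add, integral_sq_comp_add,
      integral_mul_sq_comp_add hu, integral_mul_sq_comp_add hw, iu, iw]
    refine ⟨rfl, rfl, ?_⟩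
    linear_combination -hX
  · rw [internalEnergy_pairState, realEnergy_comp_add hu hw, realEnergy_eq hu hw iu iw hc hd, iu,
      iw, ← hX]
    -- The two sides differ by exactly ω²(X - ξ)²/2.
    nlinarith [mul_nonneg (sq_nonneg ω) (sq_nonneg (X - ξ))]

theorem exists_shifts (hω : 0 < ω) (g lam σ ξ : ℝ) :
    ∃ c d : ℝ, ω ^ 2 * (c + ξ) = lam * g * (1 - σ) ∧ ω ^ 2 * (d + ξ) = - (lam * g * (1 + σ)) :=
  ⟨lam * g * (1 - σ) / ω ^ 2 - ξ, - (lam * g * (1 + σ)) / ω ^ 2 - ξ, by field_simp; ring,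
    by field_simp; ring⟩

theorem OscDomain.strictlyPositive_toL2 (hu : OscDomain u) (h : ∀ x, 0 < u x) :
    StrictlyPositive hu.toL2 :=
  ⟨u, hu.continuous, h, hu.coeFn_toL2⟩

theorem exists_isPositiveOptimizer (hω : 0 < ω) (ht : 0 ≤ t) (g lam ξ : ℝ)
    (hσ : σ ∈ Icc (-1 : ℝ) 1) : ∃ ψ, IsPositiveOptimizer ω t g lam σ ξ ψ := by
  obtain ⟨c, d, hc, hd⟩ := exists_shifts hω g lam σ ξ
  obtain ⟨u, w, hu, hw, u0, w0, iu, iw, hmin⟩ := exists_pairEnergy_minimizer hω ht c d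
    (a := (1 + σ) / 2) (b := (1 - σ) / 2) (by linarith [hσ.1]) (by linarith [hσ.2])
  obtain ⟨s, hs, hle⟩ := exists_comp_add_realEnergy_le (t := t) hu hw iu iw hc hd
  refine ⟨_, ⟨hs, fun ψ hψ => ?_⟩, fun h => ?_, fun h => ?_⟩
  · obtain ⟨u', w', hu', hw', -, -, hD, hE⟩ := exists_realEnergy_le (ω := ω) (g := g) (lam := lam)
      ht hψ.1
    obtain ⟨iu', iw', hx⟩ := (hD.mem_constraintManifold_iff hu' hw' hψ.1).1 hψ
    rw [realEnergy_eq hu' hw' iu' iw' hc hd, hx] at hE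
    have := hmin u' w' hu' hw' iu' iw'
    simp only [Set.mem_ofPred_eq]
    linarith
  · have ha : 0 < (1 + σ) / 2 := by
      have := lt_of_le_of_ne hσ.1 (Ne.symm h)
      linarith
    -- With w held fixed, u minimizes its own part of the pair energy.
    refine (hu.comp_add s).strictlyPositive_toL2 fun x => pos_of_minimizer (ω := ω) (c := c) ht ha
      hu hw u0 w0 iu (fun u' hu' iu' => ?_) (x + s)
    have := hmin u' w hu' hw iu' iw
    simp only [pairEnergy] at this
    linarith
  · have hb : 0 < (1 - σ) / 2 := by
      have := lt_of_le_of_ne hσ.2 h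
      linarith
    refine (hw.comp_add s).strictlyPositive_toL2 fun x => pos_of_minimizer (ω := ω) (c := d) ht hb
      hw hu w0 u0 iw (fun w' hw' iw' => ?_) (x + s)
    have := hmin u w' hu hw' iu iw'
    simp only [pairEnergy] at this
    simp only [mul_comm _ (u _)]
    linarith

/-- A component which is strictly positive, or zero, equals its modulus. -/
theorem eq_toL2_of_norm_eq {f : L2} (hu : OscDomain u) (hf : ∀ᵐ x, ‖f x‖ = u x)
    (h : StrictlyPositive f ∨ f = 0) :
    f = hu.toL2 ∧ (StrictlyPositive f → ∀ x, 0 < u x) := by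
  have key : ∀ r : ℝ → ℝ, Continuous r → (∀ x, 0 < r x) → (∀ᵐ x, f x = (r x : ℂ)) → r = u := by
    intro r hr r0 hfr
    refine hr.ae_eq_iff_eq volume hu.continuous |>.1 ?_
    filter_upwards [hf, hfr] with x h1 h2
    rw [← h1, h2, Complex.norm_real, Real.norm_of_nonneg (r0 x).le]
  refine ⟨Lp.ext ?_, ?_⟩
  · rcases h with ⟨r, hr, r0, hfr⟩ | h
    · have := key r hr r0 hfr
      filter_upwards [hfr, hu.coeFn_toL2] with x h1 h2
      rw [h1, h2, this]
    · subst h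
      filter_upwards [hf, hu.coeFn_toL2, Lp.coeFn_zero ℂ 2 (volume : Measure ℝ)] with x h1 h2 h3
      rw [h3] at h1 ⊢
      rw [h2, ← h1]
      simp
  · rintro ⟨r, hr, r0, hfr⟩ x
    rw [← key r hr r0 hfr]
    exact r0 x

/-- A positive optimizer is given by real functions which minimize the pair energy. -/
theorem IsPositiveOptimizer.exists_minimizer (ht : 0 ≤ t) {ψ : State}
    (hψ : IsPositiveOptimizer ω t g lam σ ξ ψ) (hc : ω ^ 2 * (c + ξ) = lam * g * (1 - σ))
    (hd : ω ^ 2 * (d + ξ) = - (lam * g * (1 + σ))) :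
    ∃ (u w : ℝ → ℝ) (hu : OscDomain u) (hw : OscDomain w), ψ = pairState hu hw ∧
      ((1 + σ) / 2 ≠ 0 → ∀ x, 0 < u x) ∧ ((1 - σ) / 2 ≠ 0 → ∀ x, 0 < w x) ∧
      ∫ x, u x ^ 2 = (1 + σ) / 2 ∧ ∫ x, w x ^ 2 = (1 - σ) / 2 ∧
      ∀ u' w', OscDomain u' → OscDomain w' → ∫ x, u' x ^ 2 = (1 + σ) / 2 →
        ∫ x, w' x ^ 2 = (1 - σ) / 2 → pairEnergy ω t c d u w ≤ pairEnergy ω t c d u' w' := by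
  obtain ⟨⟨hM, hmin⟩, hp1, hp2⟩ := hψ
  obtain ⟨u, w, hu, hw, eu, ew, hD, -⟩ := exists_realEnergy_le (ω := ω) (g := g) (lam := lam)
    ht hM.1
  obtain ⟨iu, iw, hx⟩ := (hD.mem_constraintManifold_iff hu hw hM.1).1 hM
  have hs1 : (1 + σ) / 2 ≠ 0 → σ ≠ -1 := fun h h' => h (by rw [h']; norm_num)
  have hs2 : (1 - σ) / 2 ≠ 0 → σ ≠ 1 := fun h h' => h (by rw [h']; norm_num)
  have d1 : StrictlyPositive ψ.fst ∨ ψ.fst = 0 := by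
    by_cases h : σ = -1
    · right
      have := hD.norm_fst_sq
      rw [iu, h] at this
      simpa using this
    · exact Or.inl (hp1 h)
  have d2 : StrictlyPositive ψ.snd ∨ ψ.snd = 0 := by
    by_cases h : σ = 1
    · right
      have := hD.norm_snd_sq
      rw [iw, h] at this
      simpa using this
    · exact Or.inl (hp2 h)
  obtain ⟨e1, p1⟩ := eq_toL2_of_norm_eq hu eu d1
  obtain ⟨e2, p2⟩ := eq_toL2_of_norm_eq hw ew d2
  have hψ : ψ = pairState hu hw := by
    rw [pairState, ← e1, ← e2]
    rfl
  refine ⟨u, w, hu, hw, hψ, fun h => p1 (hp1 (hs1 h)), fun h => p2 (hp2 (hs2 h)), iu, iw,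
    fun u' w' hu' hw' iu' iw' => ?_⟩
  -- The competitor need not have displacement ξ; its translate does, and the optimizer is compared
  -- with that.
  obtain ⟨s, hs, hle⟩ := exists_comp_add_realEnergy_le (t := t) hu' hw' iu' iw' hc hd
  have h := hmin hs
  simp only [Set.mem_ofPred_eq] at h
  rw [hψ, internalEnergy_pairState, realEnergy_eq hu hw iu iw hc hd, hx] at h
  linarith

theorem IsPositiveOptimizer.unique (hω : 0 < ω) (ht : 0 ≤ t) {ψ χ : State}
    (hψ : IsPositiveOptimizer ω t g lam σ ξ ψ) (hχ : IsPositiveOptimizer ω t g lam σ ξ χ) :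
    ψ = χ := by
  obtain ⟨c, d, hc, hd⟩ := exists_shifts hω g lam σ ξ
  obtain ⟨u, w, hu, hw, rfl, u0, w0, iu, iw, hm⟩ := hψ.exists_minimizer ht hc hd
  obtain ⟨φ, θ, hφ, hθ, rfl, φ0, θ0, iφ, iθ, hm'⟩ := hχ.exists_minimizer ht hc hd
  obtain ⟨rfl, rfl⟩ := pairEnergy_minimizer_unique ht hu hφ hw hθ u0 φ0 w0 θ0 iu iφ iw iθ hm hm'
  rfl

/-! ### Concavity and the superdifferential. -/

theorem IsOptimizer.levyLieb_eq {ψ : State} (h : IsOptimizer ω t g lam σ ξ ψ) :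
    levyLieb ω t g lam σ ξ = internalEnergy ω t g lam ψ :=
  IsLeast.csInf_eq ⟨mem_image_of_mem _ h.1, by rintro _ ⟨χ, hχ, rfl⟩; exact h.2 hχ⟩

/-- Attainment of the infimum excludes the default value of `sInf` on sets unbounded below, so no
separate lower bound on the energy is required. -/
theorem levyLieb_le (hω : 0 < ω) (ht : 0 ≤ t) (hσ : σ ∈ Icc (-1 : ℝ) 1) {ψ : State}
    (hψ : ψ ∈ constraintManifold σ ξ) :
    levyLieb ω t g lam σ ξ ≤ internalEnergy ω t g lam ψ := by
  obtain ⟨χ, hχ⟩ := exists_isPositiveOptimizer hω ht g lam ξ hσ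
  rw [hχ.1.levyLieb_eq]
  exact hχ.1.2 hψ

theorem concaveOn_levyLieb (hω : 0 < ω) (ht : 0 ≤ t) (g ξ : ℝ) (hσ : σ ∈ Icc (-1 : ℝ) 1) :
    ConcaveOn ℝ univ fun lam => levyLieb ω t g lam σ ξ := by
  refine ⟨convex_univ, fun x _ y _ α β hα hβ hαβ => ?_⟩
  -- The optimizer at the intermediate coupling serves as a trial state at both end points; its
  -- energy is affine in the coupling.
  obtain ⟨ψ, hψ⟩ := exists_isPositiveOptimizer hω ht g (α • x + β • y) ξ hσ
  simp only [hψ.1.levyLieb_eq]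
  have h1 := mul_le_mul_of_nonneg_left (levyLieb_le (g := g) (lam := x) hω ht hσ hψ.1.1) hα
  have h2 := mul_le_mul_of_nonneg_left (levyLieb_le (g := g) (lam := y) hω ht hσ hψ.1.1) hβ
  obtain rfl : β = 1 - α := by linarith
  simp only [internalEnergy, smul_eq_mul] at h1 h2 ⊢
  linarith

theorem IsOptimizer.mem_superdifferential (hω : 0 < ω) (ht : 0 ≤ t) (hσ : σ ∈ Icc (-1 : ℝ) 1)
    {ψ : State} (h : IsOptimizer ω t g lam σ ξ ψ) :
    g * evSigmaZX ψ ∈ superdifferential (fun μ => levyLieb ω t g μ σ ξ) lam := by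
  intro lam'
  have h1 := levyLieb_le (g := g) (lam := lam') hω ht hσ h.1
  simp only [h.levyLieb_eq]
  simp only [internalEnergy] at h1 ⊢
  linarith

end

end QRabi

end

theorem mainTheorem12 (ω t g : ℝ) (hω : 0 < ω) (ht : 0 < t)
    (σ ξ : ℝ) (hσ : σ ∈ Set.Icc (-1 : ℝ) 1) :
    ConcaveOn ℝ Set.univ (fun μ : ℝ => QRabi.levyLieb ω t g μ σ ξ) ∧
    ∀ lam : ℝ,
      (∃! ψ : QRabi.State, QRabi.IsPositiveOptimizer ω t g lam σ ξ ψ) ∧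
      ∀ ψ : QRabi.State, QRabi.IsPositiveOptimizer ω t g lam σ ξ ψ →
        g * QRabi.evSigmaZX ψ ∈
          QRabi.superdifferential (fun μ : ℝ => QRabi.levyLieb ω t g μ σ ξ) lam := by
  refine ⟨QRabi.concaveOn_levyLieb hω ht.le g ξ hσ, fun lam => ⟨?_, fun ψ hψ =>
    hψ.1.mem_superdifferential hω ht.le hσ⟩⟩
  obtain ⟨ψ, hψ⟩ := QRabi.exists_isPositiveOptimizer hω ht.le g lam ξ hσ
  exact ⟨ψ, hψ, fun χ hχ => hχ.unique hω ht.le hψ⟩
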